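/- **Conventions.** For linear orders $I,J$, let $I+(c)+J$ be their concatenation with one point $c$ in between. The cut $(I,J)$, with $I$ and $J$ nonempty, is *Dedekind* if $I$ has no maximum and $J$ has no minimum. For a sequence of finite tuples $(\bar a_k)_{k\in I+(c)+J}$ (all of the same length) and a single element $b$ of a structure, let $(*)$ be the assumption that $(I,J)$ is Dedekind, $(\bar a_k)_{k\in I+(c)+J}$ is indiscernible, and $(\bar a_k)_{k\in I+J}$ is indiscernible over $b$. A theory is *distal* if in each of its models $(*)$ implies that $(\bar a_k)_{k\in I+(c)+J}$ is indiscernible over $b$; a structure is distal if its complete theory is. For a set $\mathcal G$ of finitary operations on a set, an $\mathcal G$-term is a term built from variables and operations in $\mathcal G$, and $\langle X\rangle_{\mathcal G}$ is the set of values of $\mathcal G$-terms at elements of $X$. **Setting.** Let $\mathcal N$ be an $L$-structure with universe $N$, let $R\subseteq N$, and let $\widetilde{\mathcal N}=(\mathcal N,R)$ be its expansion by a unary predicate for $R$, in the language $\widetilde L=L\cup\{R\}$. Let $\mathcal R$ be a structure with universe $R$ all of whose functions and relations are $\emptyset$-definable in $\widetilde{\mathcal N}$. Let $\mathcal F_N$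 be a set of operations $N^n\to N$ ($n$ varying) that are $\emptyset$-definable in $\mathcal N$, and $\mathcal F_R$ a set of operations $R^n\to R$ that are $\emptyset$-definable in $\mathcal R$. Let $\lambda:N\to R$ be a function $\emptyset$-definable in $\widetilde{\mathcal N}$. Regard each $h\in\mathcal F_R$ as an operation on $N$ by $h(x_1,\dots,x_n)=h(\lambda(x_1),\dots,\lambda(x_n))$, and let $\mathcal F=\mathcal F_N\cup\mathcal F_R\cup\{\lambda\}$. Let $\mu,\kappa$ be cardinals with $\aleph_0+|\widetilde L|<\mu$ and $2^\mu<\kappa$, and suppose that $\widetilde{\mathcal N}$ is a monster model in the sense that it is $\kappa$-saturated and strongly $\kappa$-homogeneous (every partial elementary map between subsets of size $<\kappa$ extends to an automorphism). A *truncation* of $(I,J)$ is a pair $(I',J')$ of a nonempty final segment $I'$ of $I$ and a nonempty initial segment $J'$ of $J$; *parameters outside* $(I',J')$ are components of the $\bar a_k$ with $k\in(I\setminus I')\cup(J\setminus J')$. We say that $\widetilde{\mathcal N}$ *admits variable separation* if the following holds for all $\mu$-saturated dense linear orders without endpoints $I,J$ of size $<\kappa$, all $(\bar a_k)_{k\in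 I+(c)+J}$ and $b$ in $N$ satisfying $(*)$ in $\widetilde{\mathcal N}$, and all $\mathcal F$-terms $t(\bar x,y)$: there are a truncation $(I',J')$ of $(I,J)$, an $\mathcal F_N$-term $u(\bar z,\bar w)$, and finite tuples of $\mathcal F$-terms $\bar r(\bar x)$ and $\bar s(y)$ involving parameters outside $(I',J')$, such that $$t(\bar a_k,b)=u(\bar r(\bar a_k),\bar s(b))\qquad\text{for all }k\in I'+(c)+J',$$ and such that, if $t$ is of the form $h(\bar t)$ with $h\in\mathcal F_R\cup\{\lambda\}$, all components of $\bar s(b)$ lie in $R$. **Theorem.** Suppose that: 1. $\mathcal N$ and $\mathcal R$ are distal. 2. For every $M\subseteq N$ with $|M|<\kappa$ and $\langle M\rangle_{\mathcal F}=M$, and all $b,b'\in R$: if $\mathrm{tp}^{\mathcal R}(b/M\cap R)=\mathrm{tp}^{\mathcal R}(b'/M\cap R)$, then $\mathrm{tp}^{\widetilde{\mathcal N}}(b/M)=\mathrm{tp}^{\widetilde{\mathcal N}}(b'/M)$. 3. For every $M\subseteq N$ with $|M|<\kappa$ and $\langle M\rangle_{\mathcal F}=M$, and all $b,b'\in N$: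 if $\mathrm{tp}^{\mathcal N}(b/M)=\mathrm{tp}^{\mathcal N}(b'/M)$ and $\lambda(x)\in M$ for all $x\in\langle \{b\}\cup M\rangle_{\mathcal F_N}$, then $\mathrm{tp}^{\widetilde{\mathcal N}}(b/M)=\mathrm{tp}^{\widetilde{\mathcal N}}(b'/M)$. 4. $\widetilde{\mathcal N}$ admits variable separation. Then $\widetilde{\mathcal N}$ is distal. -/

import Mathlib

open FirstOrder
open scoped FirstOrder Cardinal

universe u

namespace DistalExpansion

section Generalities

variable (L : FirstOrder.Language.{u, u}) {M : Type u} [L.Structure M]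

/-- The (possibly infinite) tuples `x` and `y` have the same type over the parameter set `A`. -/
def SameType (A : Set M) {α : Type*} (x y : α → M) : Prop :=
  ∀ φ : L[[A]].Formula α, φ.Realize x ↔ φ.Realize y

/-- The sequence of tuples `(a_k)`, `k` in the linear order `K`, is indiscernible over `A`. -/
def IndiscernibleOver (A : Set M) {K : Type u} [LinearOrder K] {n : ℕ}
    (a : K → Fin n → M) : Prop :=
  ∀ (m : ℕ) (s t : Fin m → K), StrictMono s → StrictMono t →
    SameType L A (fun p : Fin m × Fin n => a (s p.1) p.2) (fun p => a (t p.1) p.2)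

/-- A linear order of the form `I + (c) + J` is a linear order `K` with a distinguished point `c`,
where `I` is the set of points below `c` and `J` the set of points above `c`.  The cut `(I, J)`
(with `I` and `J` nonempty) is Dedekind if `I` has no maximum and `J` has no minimum. -/
structure IsDedekindAt {K : Type u} [LinearOrder K] (c : K) : Prop where
  nonempty_left : ∃ i, i < c
  nonempty_right : ∃ j, c < j
  no_max_left : ∀ i, i < c → ∃ i', i < i' ∧ i' < c
  no_min_right : ∀ j, c < j → ∃ j', c < j' ∧ j' < j

/-- The assumptions on a sequence `(a_k)`, `k ∈ I + (c) + J`, and a single element `b` in the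
definition of distality. -/
structure DistalityAssumptions {K : Type u} [LinearOrder K] (c : K) {n : ℕ}
    (a : K → Fin n → M) (b : M) : Prop where
  dedekind : IsDedekindAt c
  indiscernible : IndiscernibleOver L ∅ a
  indiscernible_over : IndiscernibleOver L {b} (fun k : {k : K // k ≠ c} => a k)

/-- A theory is distal if, in every model, a sequence indexed by `I + (c) + J` is indiscernible
over `b` as soon as the above assumptions hold. -/
def TheoryIsDistal {L : FirstOrder.Language.{u, u}} (T : L.Theory) : Prop :=
  ∀ (M : Type u) [L.Structure M] [M ⊨ T] (K : Type u) [LinearOrder K] (c : K) (n : ℕ)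
    (a : K → Fin n → M) (b : M),
    DistalityAssumptions L c a b → IndiscernibleOver L {b} a

variable (M) in
/-- A structure is distal if its complete theory is. -/
def IsDistal : Prop := TheoryIsDistal (L.completeTheory M)

variable (M) in
/-- `κ`-saturation: every finitely satisfiable set of formulas in one variable over fewer than
`κ` parameters is realized. -/
def IsSaturated (κ : Cardinal.{u}) : Prop :=
  ∀ A : Set M, #A < κ → ∀ p : Set (L[[A]].Formula Unit),
    (∀ q : Finset (L[[A]].Formula Unit), (q : Set (L[[A]].Formula Unit)) ⊆ p →
      ∃ x : M, ∀ φ ∈ q, φ.Realize (fun _ => x)) →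
    ∃ x : M, ∀ φ ∈ p, φ.Realize (fun _ => x)

variable (M) in
/-- Strong `κ`-homogeneity: partial elementary maps between sets of fewer than `κ` elements
extend to automorphisms. -/
def IsStronglyHomogeneous (κ : Cardinal.{u}) : Prop :=
  ∀ (ι : Type u) (x y : ι → M), #ι < κ → SameType L ∅ x y →
    ∃ σ : M ≃[L] M, ∀ i, σ (x i) = y i

end Generalities

/-- `X` is a `μ`-saturated dense linear order without endpoints.  By quantifier elimination this
says that whenever `A < B` are subsets with fewer than `μ` elements, some point lies strictly
between `A` and `B` (the cases where `A` or `B` is empty exclude endpoints). -/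
def IsSaturatedDLO (μ : Cardinal.{u}) (X : Type u) [LinearOrder X] : Prop :=
  ∀ A B : Set X, #A < μ → #B < μ → (∀ a ∈ A, ∀ b ∈ B, a < b) →
    ∃ x, (∀ a ∈ A, a < x) ∧ ∀ b ∈ B, x < b

section Expansion

/-- The only symbol of the language `{R}`: a unary relation symbol. -/
inductive UnaryRel : ℕ → Type
  | mem : UnaryRel 1

/-- The language `{R}` with a single unary relation symbol. -/
def unaryLang : FirstOrder.Language.{0, 0} := ⟨fun _ => Empty, UnaryRel⟩

/-- The subset of `N` named by `R`.  A structure for the language `{R}` on `N` is nothing but the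
choice of this subset. -/
def predSet (N : Type u) [unaryLang.Structure N] : Set N :=
  {x | FirstOrder.Language.Structure.RelMap (L := unaryLang) (n := 1) UnaryRel.mem ![x]}

/-- The language `L ∪ {R}` of the expansion `(N, R)` of an `L`-structure `N`. -/
abbrev withPred (L : FirstOrder.Language.{u, u}) : FirstOrder.Language.{u, u} := L.sum unaryLang

end Expansion

section Operations

/-- Finitary operations `X ^ n → X`, with `n` varying. -/
abbrev Op (X : Type u) : Type u := Σ n : ℕ, ((Fin n → X) → X)

/-- The operation `f` is definable without parameters, i.e. its graph is. -/
def OpDefinable (L : FirstOrder.Language.{u, u}) {X : Type u} [L.Structure X] (f : Op X) : Prop :=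
  (∅ : Set X).Definable L
    {x : Fin (f.1 + 1) → X | x (Fin.last f.1) = f.2 (fun i => x i.castSucc)}

/-- The functional language which has the operations in `F` as its function symbols. -/
def opLang {X : Type u} (F : Set (Op X)) : FirstOrder.Language.{u, 0} :=
  ⟨fun n => {f : (Fin n → X) → X // (⟨n, f⟩ : Op X) ∈ F}, fun _ => Empty⟩

/-- Each symbol is interpreted by the operation that it is; terms of `opLang F` are `F`-terms. -/
instance {X : Type u} (F : Set (Op X)) : (opLang F).Structure X where
  funMap f x := f.1 x
  RelMap r _ := r.elim

/-- The subset `⟨A⟩_F` generated by `A` under `F`: all values at `A` of terms involving `F`. -/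
def generated {X : Type u} (F : Set (Op X)) (A : Set X) : Set X :=
  {y | ∃ t : (opLang F).Term A, t.realize (fun x : A => (x : X)) = y}

variable {N : Type u} {R : Set N}

/-- The function `lam : N → R` as a unary operation on `N`. -/
def lamOp (lam : N → R) : Op N := ⟨1, fun x => (lam (x 0) : N)⟩

/-- An operation `h` on `R`, regarded as the operation
`h (lam x₁, …, lam xₙ)` on `N`. -/
def liftOp (lam : N → R) (h : Op R) : Op N :=
  ⟨h.1, fun x => (h.2 (fun i => lam (x i)) : N)⟩

/-- `F_R ∪ {lam}`, regarded as a set of operations on `N`. -/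
def opsR (FR : Set (Op R)) (lam : N → R) : Set (Op N) := liftOp lam '' FR ∪ {lamOp lam}

/-- `F = F_N ∪ F_R ∪ {lam}`. -/
def allOps (FN : Set (Op N)) (FR : Set (Op R)) (lam : N → R) : Set (Op N) :=
  FN ∪ opsR FR lam

/-- The term `t` is of the form `h(t₁, …, tₗ)` with `h ∈ G`. -/
def HasHeadIn {F : Set (Op N)} (G : Set (Op N)) {α : Type*} (t : (opLang F).Term α) : Prop :=
  ∃ (l : ℕ) (h : (opLang F).Functions l) (ts : Fin l → (opLang F).Term α),
    t = FirstOrder.Language.Term.func h ts ∧ (⟨l, h.1⟩ : Op N) ∈ G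

end Operations

section DefinableStructure

/-- The `LR`-structure on the subset `R` of `N` is definable without parameters in the
`L`-structure `N`: the graphs of its functions and its relations are. -/
structure StructureDefinable (L LR : FirstOrder.Language.{u, u}) {N : Type u} [L.Structure N]
    (R : Set N) [LR.Structure R] : Prop where
  fun_definable : ∀ (n : ℕ) (f : LR.Functions n), (∅ : Set N).Definable L
    {x : Fin (n + 1) → N | ∃ y : Fin n → R, (∀ i, x i.castSucc = y i) ∧
      x (Fin.last n) = FirstOrder.Language.Structure.funMap f y}
  rel_definable : ∀ (n : ℕ) (r : LR.Relations n), (∅ : Set N).Definable L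
    {x : Fin n → N | ∃ y : Fin n → R, (∀ i, x i = y i) ∧ FirstOrder.Language.Structure.RelMap r y}

end DefinableStructure

section VariableSeparation

/-- `(I', J')` is a truncation of `(I, J)`: `I'` is a nonempty final segment of `I` and `J'` is a
nonempty initial segment of `J`. -/
structure IsTruncation {K : Type u} [LinearOrder K] (c : K) (I' J' : Set K) : Prop where
  left_subset : ∀ i ∈ I', i < c
  left_nonempty : I'.Nonempty
  left_final : ∀ i ∈ I', ∀ k, i < k → k < c → k ∈ I'
  right_subset : ∀ j ∈ J', c < j
  right_nonempty : J'.Nonempty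
  right_initial : ∀ j ∈ J', ∀ k, c < k → k < j → k ∈ J'

/-- All the parameters outside `(I', J')`: the components of the `a_k` for
`k ∈ (I \ I') ∪ (J \ J')`. -/
def outsideParams {N K : Type u} [LinearOrder K] (c : K) {n : ℕ} (a : K → Fin n → N)
    (I' J' : Set K) : Set N :=
  {x | ∃ k, ((k < c ∧ k ∉ I') ∨ (c < k ∧ k ∉ J')) ∧ ∃ i, x = a k i}

/-- The expansion `(N, R)` admits variable separation.  The sequences considered have fewer than
`κ` members and are indexed by `I + (c) + J`, where `I` and `J` are `μ`-saturated dense linear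
orders without endpoints. -/
def AdmitsVariableSeparation (L : FirstOrder.Language.{u, u}) {N : Type u} [L.Structure N]
    [unaryLang.Structure N] (FN : Set (Op N)) (FR : Set (Op (predSet N)))
    (lam : N → predSet N) (κ μ : Cardinal.{u}) : Prop :=
  ∀ (K : Type u) [LinearOrder K] (c : K), #K < κ →
    IsSaturatedDLO μ (Set.Iio c) → IsSaturatedDLO μ (Set.Ioi c) →
  ∀ (n : ℕ) (a : K → Fin n → N) (b : N), DistalityAssumptions (withPred L) c a b →
  ∀ t : (opLang (allOps FN FR lam)).Term (Fin n ⊕ Unit),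
  ∃ I' J' : Set K, IsTruncation c I' J' ∧
  ∃ (p q : ℕ) (v : (opLang FN).Term (Fin p ⊕ Fin q))
    (r : Fin p → (opLang (allOps FN FR lam)).Term (Fin n ⊕ outsideParams c a I' J'))
    (s : Fin q → (opLang (allOps FN FR lam)).Term (Unit ⊕ outsideParams c a I' J')),
    (∀ k, k ∈ I' ∨ k = c ∨ k ∈ J' →
      t.realize (Sum.elim (a k) (fun _ => b)) =
        v.realize (Sum.elim
          (fun j => (r j).realize (Sum.elim (a k) Subtype.val))
          (fun j => (s j).realize (Sum.elim (fun _ => b) Subtype.val)))) ∧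
    (HasHeadIn (opsR FR lam) t →
      ∀ j, (s j).realize (Sum.elim (fun _ => b) Subtype.val) ∈ predSet N)

end VariableSeparation

end DistalExpansion

open DistalExpansion

/-! Work in the monster model. Moving one index at a time past the cut
(`indiscernibleOver_of_single`), it is enough to show that `a c` and some `a c'` with `c' ≠ c` have
the same type over `b`. By `isDistal_of_isSaturated` it is also enough to treat sequences in the
monster indexed by one fixed order of size less than `κ`. A `μ`-saturated dense order of size at
most `2 ^ μ` is used, so that variable separation applies and fewer than `μ` truncations always have
a common refinement.

If `b ∈ R`, let `σ` be an automorphism taking `a c` to `a c'`, and let `M` be the closure of `a c'`.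
Tuples of terms in `a k` with values in `R` form a sequence in the structure on `R` that satisfies
the same assumptions. Its distality shows that `b` and `σ b` have the same type over `M ∩ R`.
Hypothesis `h2` lifts this to the type over `M` in the expansion, and applying `σ⁻¹` gives the claim
(`exists_eqTp_of_mem_predSet`).

For general `b` the same argument, with distality of `N` and `h3` in place of distality of `R` and
`h2`, works as soon as `M` contains `lam x` for all `x` generated by `b` and `M`
(`eqTp_of_lam_mem`). To reach this, parameters must be added to `a c'`, and the sequence has to stay
indiscernible over them, including at `c`. The set `derived i j` supplies them: its new elements lie
in `R`, so they can be adjoined one by one using the first case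
(`DistalityAssumptions.ind_derived`). Variable separation for `lam t` writes the value through terms
in `a k` and terms in `b`; the latter have values in `R`, hence in a derived set, at the cost of
shrinking the interval (`AdmitsVariableSeparation.exists_truncation`). Closing off under all terms
takes at most `ν = max ℵ₀ |L ∪ {R}|` parameters and truncations, and since `ν < μ`, one interval
around `c` serves for all of them. -/

namespace DistalExpansion

/-! ### Types over the empty set and over parameters -/

section EqTp

variable (L : FirstOrder.Language.{u, u}) {M : Type u} [L.Structure M]

/-- The tuples `x` and `y` have the same type over the empty set. -/
def EqTp {α : Type*} (x y : α → M) : Prop :=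
  ∀ φ : L.Formula α, φ.Realize x ↔ φ.Realize y

variable {L}

theorem EqTp.symm {α : Type*} {x y : α → M} (h : EqTp L x y) : EqTp L y x :=
  fun φ => (h φ).symm

theorem EqTp.trans {α : Type*} {x y z : α → M} (h : EqTp L x y) (h' : EqTp L y z) :
    EqTp L x z :=
  fun φ => (h φ).trans (h' φ)

theorem EqTp.comp {α β : Type*} {x y : α → M} (h : EqTp L x y) (f : β → α) :
    EqTp L (x ∘ f) (y ∘ f) := fun φ => by
  rw [← FirstOrder.Language.Formula.realize_relabel, ← FirstOrder.Language.Formula.realize_relabel]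
  exact h _

theorem EqTp.of_equiv {α : Type*} (σ : M ≃[L] M) {x y : α → M} (h : ∀ i, σ (x i) = y i) :
    EqTp L x y := fun φ => by
  rw [show y = σ ∘ x from funext fun i => (h i).symm]
  exact (FirstOrder.Language.StrongHomClass.realize_formula σ φ).symm

/-- Equality of types is decided by finite subtuples. -/
theorem EqTp.of_finite {α : Type*} {x y : α → M}
    (h : ∀ (l : ℕ) (f : Fin l → α), EqTp L (x ∘ f) (y ∘ f)) : EqTp L x y := by
  classical
  intro φ
  let e := φ.freeVarFinset.equivFin
  have key : ∀ z : α → M, (FirstOrder.Language.BoundedFormula.restrictFreeVar φ e).Realize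
      (z ∘ fun j => (e.symm j : α)) default ↔ φ.Realize z := fun z =>
    FirstOrder.Language.BoundedFormula.realize_restrictFreeVar z (by simp)
  rw [← key x, ← key y]
  exact h _ (fun j => (e.symm j : α)) _

/-- Two tuples have the same type if each pair of corresponding finite subtuples is a subtuple of
a pair of tuples with the same type. -/
theorem EqTp.of_local.{w, v} {α : Type v} {x y : α → M}
    (h : ∀ (l : ℕ) (f : Fin l → α), ∃ (β : Type w) (x' y' : β → M), EqTp L x' y' ∧
      ∀ j, ∃ z, x' z = x (f j) ∧ y' z = y (f j)) : EqTp L x y :=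
  EqTp.of_finite fun l f => by
    obtain ⟨β, x', y', h', hz⟩ := h l f
    choose z hx hy using hz
    have := h'.comp z
    rwa [show x' ∘ z = x ∘ f from funext hx, show y' ∘ z = y ∘ f from funext hy] at this

/-- Equality of types over `A ∪ B` is decided by adjoining finite tuples from `A`. -/
theorem EqTp.of_union {α : Type*} {A B : Set M} {x y : α → M}
    (h : ∀ (l : ℕ) (p : Fin l → M), (∀ i, p i ∈ A) →
      EqTp L (Sum.elim (Subtype.val : B → M) (Sum.elim x p)) (Sum.elim Subtype.val (Sum.elim y p))) :
    EqTp L (Sum.elim (Subtype.val : ↥(A ∪ B) → M) x) (Sum.elim Subtype.val y) := by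
  refine EqTp.of_local fun l f => ?_
  let P : Set M := Set.range (Sum.elim (Subtype.val : ↥(A ∪ B) → M) x ∘ f) ∩ A
  have : Finite P := ((Set.finite_range _).subset Set.inter_subset_left).to_subtype
  obtain ⟨d, ⟨e⟩⟩ := Finite.exists_equiv_fin P
  refine ⟨_, _, _, h d (fun i => (e.symm i : M)) (fun i => (e.symm i).2.2), fun j => ?_⟩
  rcases hj : f j with ⟨z, hz⟩ | i
  · by_cases hzA : z ∈ A
    · have hzP : z ∈ P := ⟨⟨j, by simp [hj]⟩, hzA⟩
      exact ⟨Sum.inr (Sum.inr (e ⟨z, hzP⟩)), by simp, by simp⟩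
    · exact ⟨Sum.inl ⟨z, hz.resolve_left hzA⟩, by simp, by simp⟩
  · exact ⟨Sum.inr (Sum.inl i), by simp, by simp⟩

theorem EqTp.of_comp {α β : Type*} {x y : α → M} {x' y' : β → M} (h : EqTp L x' y')
    (hz : ∀ i, ∃ z, x' z = x i ∧ y' z = y i) : EqTp L x y := by
  choose z hx hy using hz
  have := h.comp z
  rwa [show x' ∘ z = x from funext hx, show y' ∘ z = y from funext hy] at this

theorem realize_constantsVarsEquiv_iff {A : Set M} {α : Type*} (ψ : L[[A]].Formula α) (v : α → M) :
    FirstOrder.Language.Formula.Realize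
      (FirstOrder.Language.BoundedFormula.constantsVarsEquiv ψ)
      (Sum.elim (Subtype.val : A → M) v) ↔ ψ.Realize v := by
  have := FirstOrder.Language.BoundedFormula.realize_constantsVarsEquiv
    (φ := ψ) (v := v) (xs := default)
  simpa [FirstOrder.Language.Formula.Realize] using this

/-- Constants for elements of `A` can be traded for free variables. Types over parameters thus
become types of longer tuples over `∅`, and changes of parameters become reindexings. -/
theorem sameType_iff {A : Set M} {α : Type*} {x y : α → M} :
    SameType L A x y ↔
      EqTp L (Sum.elim (Subtype.val : A → M) x) (Sum.elim (Subtype.val : A → M) y) := by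
  constructor
  · intro h φ
    have := h (FirstOrder.Language.BoundedFormula.constantsVarsEquiv.symm φ)
    rwa [← realize_constantsVarsEquiv_iff, ← realize_constantsVarsEquiv_iff,
      Equiv.apply_symm_apply] at this
  · intro h ψ
    rw [← realize_constantsVarsEquiv_iff, ← realize_constantsVarsEquiv_iff]
    exact h _

theorem sameType_empty_iff {α : Type*} {x y : α → M} : SameType L ∅ x y ↔ EqTp L x y := by
  rw [sameType_iff]
  refine ⟨fun h => h.comp Sum.inr, fun h => h.of_comp ?_⟩
  rintro (a | i)
  · exact a.2.elim
  · exact ⟨i, rfl, rfl⟩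

end EqTp

/-! ### Indiscernible sequences, and reduction to single members -/

section Ind

variable (L : FirstOrder.Language.{u, u}) {M : Type u} [L.Structure M]

/-- The sequence `(a_k)`, restricted to the indices `k ∈ S`, is indiscernible over `A`. -/
def Ind (A : Set M) {K : Type u} [LinearOrder K] {n : ℕ} (a : K → Fin n → M) (S : Set K) : Prop :=
  ∀ (m : ℕ) (s t : Fin m → K), StrictMono s → StrictMono t → (∀ i, s i ∈ S) → (∀ i, t i ∈ S) →
    EqTp L (Sum.elim (Subtype.val : A → M) (fun p : Fin m × Fin n => a (s p.1) p.2))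
      (Sum.elim Subtype.val (fun p : Fin m × Fin n => a (t p.1) p.2))

/-- The components of the `a_k` with `k ∈ T`. -/
def components {K : Type u} {n : ℕ} (a : K → Fin n → M) (T : Set K) : Set M :=
  {x | ∃ k ∈ T, ∃ v, x = a k v}

variable {L} {K : Type u} [LinearOrder K] {n : ℕ} {a : K → Fin n → M}

theorem Ind.mono {A B : Set M} {S T : Set K} (h : Ind L B a T) (hAB : A ⊆ B) (hST : S ⊆ T) :
    Ind L A a S := fun m s t hs ht hsS htS => by
  refine (h m s t hs ht (fun i => hST (hsS i)) (fun i => hST (htS i))).of_comp ?_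
  rintro (x | p)
  · exact ⟨Sum.inl ⟨x, hAB x.2⟩, rfl, rfl⟩
  · exact ⟨Sum.inr p, rfl, rfl⟩

theorem indiscernibleOver_iff {A : Set M} : IndiscernibleOver L A a ↔ Ind L A a Set.univ := by
  simp only [IndiscernibleOver, Ind, sameType_iff, Set.mem_univ, implies_true, forall_const]

theorem Ind.comp {A : Set M} {S : Set K} (h : Ind L A a S) {K' : Type u} [LinearOrder K']
    {f : K' → K} (hf : StrictMono f) {S' : Set K'} (hS : ∀ k ∈ S', f k ∈ S) :
    Ind L A (fun k => a (f k)) S' := fun m s t hs ht hsS htS =>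
  h m (f ∘ s) (f ∘ t) (hf.comp hs) (hf.comp ht) (fun i => hS _ (hsS i)) (fun i => hS _ (htS i))

theorem indiscernibleOver_subtype_iff {A : Set M} {p : K → Prop} :
    IndiscernibleOver L A (fun k : {k // p k} => a k) ↔ Ind L A a {k | p k} := by
  rw [indiscernibleOver_iff]
  constructor
  · intro h m s t hs ht hsS htS
    exact h m (fun i => ⟨s i, hsS i⟩) (fun i => ⟨t i, htS i⟩) (fun _ _ hij => hs hij)
      (fun _ _ hij => ht hij) (fun _ => trivial) (fun _ => trivial)
  · intro h
    exact h.comp (f := fun k : {k // p k} => (k : K)) (fun _ _ hij => hij) (fun k _ => k.2)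

/-- Two families of indices with the same order pattern yield tuples of the same type. -/
theorem Ind.eqTp {A : Set M} {S : Set K} (h : Ind L A a S) {ι : Type u} (s t : ι → K)
    (hs : ∀ i, s i ∈ S) (ht : ∀ i, t i ∈ S) (hst : ∀ i j, s i < s j ↔ t i < t j) :
    EqTp L (Sum.elim (Subtype.val : A → M) (fun p : ι × Fin n => a (s p.1) p.2))
      (Sum.elim Subtype.val (fun p : ι × Fin n => a (t p.1) p.2)) := by
  classical
  have hst' : ∀ i j, s i = s j → t i = t j := fun i j hij => by
    have h1 := hst i j
    have h2 := hst j i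
    rw [hij] at h1 h2
    exact le_antisymm (not_lt.1 fun h => lt_irrefl _ (h2.2 h))
      (not_lt.1 fun h => lt_irrefl _ (h1.2 h))
  refine EqTp.of_local fun l f => ?_
  let F : Finset ι := Finset.univ.biUnion fun j : Fin l =>
    Sum.elim (fun _ => ∅) (fun p : ι × Fin n => {p.1}) (f j)
  let P : Finset K := F.image s
  let e := P.orderIsoOfFin rfl
  have hP : ∀ k : P, ∃ i, s i = k := fun k => by
    obtain ⟨i, -, hi⟩ := Finset.mem_image.1 k.2
    exact ⟨i, hi⟩
  choose g hg using hP
  refine ⟨_, _, _, h P.card (fun i => s (g (e i))) (fun i => t (g (e i))) ?_ ?_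
    (fun _ => hs _) (fun _ => ht _), fun j => ?_⟩
  · intro i j hij
    simp only [hg]
    exact e.strictMono hij
  · intro i j hij
    rw [← hst, hg, hg]
    exact e.strictMono hij
  · rcases hj : f j with z | ⟨i, v⟩
    · exact ⟨Sum.inl z, rfl, rfl⟩
    · have hi : s i ∈ P := Finset.mem_image_of_mem _
        (Finset.mem_biUnion.2 ⟨j, Finset.mem_univ _, by simp [hj]⟩)
      have h1 : s (g (e (e.symm ⟨s i, hi⟩))) = s i := by simp [hg]
      refine ⟨Sum.inr (e.symm ⟨s i, hi⟩, v), ?_, ?_⟩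
      · simp only [Sum.elim_inr, h1]
      · simp only [Sum.elim_inr, hst' _ _ h1]

/-- An indiscernible sequence is indiscernible on an interval over its members outside of it. -/
theorem Ind.outside {A : Set M} {S : Set K} (h : Ind L A a S) (i j : K) :
    Ind L (A ∪ components a (S \ Set.Ioo i j)) a (S ∩ Set.Ioo i j) := by
  intro m s t hs ht hsS htS
  -- A point outside the interval compares with every point of the interval in the same way, so
  -- exchanging `s` and `t` does not change the order pattern relative to the outside indices.
  have key : ∀ (r : Fin m → K), (∀ x, r x ∈ Set.Ioo i j) → ∀ (x : Fin m) (y : K),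
      y ∉ Set.Ioo i j → (r x < y ↔ j ≤ y) ∧ (y < r x ↔ y ≤ i) := by
    intro r hr x y hy
    have := hr x
    simp only [Set.mem_Ioo, not_and_or, not_lt] at hy this
    constructor
    · exact ⟨fun hlt => hy.resolve_left fun hyi =>
        absurd (lt_of_lt_of_le hlt hyi) (not_lt.2 this.1.le), fun hj => this.2.trans_le hj⟩
    · exact ⟨fun hlt => hy.resolve_right fun hyj =>
        absurd (lt_of_le_of_lt hyj hlt) (not_lt.2 this.2.le), fun hi => hi.trans_lt this.1⟩
  have := h.eqTp (ι := Fin m ⊕ ↥(S \ Set.Ioo i j)) (Sum.elim s Subtype.val)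
    (Sum.elim t Subtype.val)
    (by rintro (x | x); exacts [(hsS x).1, x.2.1]) (by rintro (x | x); exacts [(htS x).1, x.2.1])
    (by
      rintro (x | x) (y | y)
      · simp [hs.lt_iff_lt, ht.lt_iff_lt]
      · simp [(key s (fun x => (hsS x).2) x y y.2.2).1, (key t (fun x => (htS x).2) x y y.2.2).1]
      · simp [(key s (fun x => (hsS x).2) y x x.2.2).2, (key t (fun x => (htS x).2) y x x.2.2).2]
      · rfl)
  refine this.of_comp ?_
  rintro (⟨x, hx | ⟨k, hk, v, rfl⟩⟩ | ⟨p, v⟩)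
  · exact ⟨Sum.inl ⟨x, hx⟩, rfl, rfl⟩
  · exact ⟨Sum.inr (Sum.inr ⟨k, hk⟩, v), rfl, rfl⟩
  · exact ⟨Sum.inr (Sum.inl p, v), rfl, rfl⟩

/-- Parameters can be adjoined to the members of an indiscernible sequence. -/
theorem Ind.append {A B : Set M} {S : Set K} (h : Ind L (A ∪ B) a S) {l : ℕ} {p : Fin l → M}
    (hp : ∀ i, p i ∈ A) : Ind L B (fun k => Fin.append (a k) p) S := by
  intro m s t hs ht hsS htS
  refine (h m s t hs ht hsS htS).of_comp ?_
  rintro (x | ⟨i, v⟩)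
  · exact ⟨Sum.inl ⟨x, Or.inr x.2⟩, rfl, rfl⟩
  · induction v using Fin.addCases with
    | left v => exact ⟨Sum.inr (i, v), by simp, by simp⟩
    | right v => exact ⟨Sum.inl ⟨p v, Or.inl (hp v)⟩, by simp, by simp⟩

/-- Only finitely many elements of `A` enter a formula. This converts a statement about sequences of
longer tuples over `B` into one with parameters from `A`, so that distality for a single `b` also
handles additional parameters. -/
theorem Ind.of_append {A B : Set M} {S : Set K}
    (h : ∀ (l : ℕ) (p : Fin l → M), (∀ i, p i ∈ A) → Ind L B (fun k => Fin.append (a k) p) S) :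
    Ind L (A ∪ B) a S := by
  intro m s t hs ht hsS htS
  -- For `m = 0` no member of the sequence carries the tuple `p`, but then `s = t`.
  obtain rfl | ⟨m, rfl⟩ : m = 0 ∨ ∃ m', m = m' + 1 := by cases m <;> simp
  · rw [Subsingleton.elim s t]
    exact fun φ => Iff.rfl
  refine EqTp.of_union fun l p hp => (h l p hp _ s t hs ht hsS htS).of_comp ?_
  rintro (x | ⟨i, v⟩ | v)
  · exact ⟨Sum.inl x, rfl, rfl⟩
  · exact ⟨Sum.inr (i, Fin.castAdd _ v), by simp, by simp⟩
  · exact ⟨Sum.inr (0, Fin.natAdd _ v), by simp, by simp⟩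

theorem Ind.single {A : Set M} {S : Set K} (h : Ind L A a S) {k k' : K} (hk : k ∈ S)
    (hk' : k' ∈ S) : EqTp L (Sum.elim (Subtype.val : A → M) (a k)) (Sum.elim Subtype.val (a k')) := by
  refine (h 1 (fun _ => k) (fun _ => k') (Subsingleton.strictMono _) (Subsingleton.strictMono _)
    (fun _ => hk) (fun _ => hk')).of_comp ?_
  rintro (x | v)
  · exact ⟨Sum.inl x, rfl, rfl⟩
  · exact ⟨Sum.inr (0, v), rfl, rfl⟩

theorem distalityAssumptions_iff {c : K} {b : M} : DistalityAssumptions L c a b ↔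
    IsDedekindAt c ∧ Ind L ∅ a Set.univ ∧ Ind L {b} a {k | k ≠ c} := by
  constructor
  · intro h
    exact ⟨h.dedekind, indiscernibleOver_iff.1 h.indiscernible,
      indiscernibleOver_subtype_iff.1 h.indiscernible_over⟩
  · rintro ⟨h1, h2, h3⟩
    exact ⟨h1, indiscernibleOver_iff.2 h2, indiscernibleOver_subtype_iff.2 h3⟩

theorem IsDedekindAt.Ioo {c : K} (h : IsDedekindAt c) {i j : K} (hc : c ∈ Set.Ioo i j) :
    IsDedekindAt (⟨c, hc⟩ : Set.Ioo i j) where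
  nonempty_left := by
    obtain ⟨x, h1, h2⟩ := h.no_max_left i hc.1
    exact ⟨⟨x, h1, h2.trans hc.2⟩, h2⟩
  nonempty_right := by
    obtain ⟨x, h1, h2⟩ := h.no_min_right j hc.2
    exact ⟨⟨x, hc.1.trans h1, h2⟩, h1⟩
  no_max_left := by
    rintro ⟨x, hx⟩ hxc
    obtain ⟨y, h1, h2⟩ := h.no_max_left x hxc
    exact ⟨⟨y, hx.1.trans h1, (show y < c from h2).trans hc.2⟩, h1, h2⟩
  no_min_right := by
    rintro ⟨x, hx⟩ hxc
    obtain ⟨y, h1, h2⟩ := h.no_min_right x hxc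
    exact ⟨⟨y, hc.1.trans h1, h2.trans hx.2⟩, h1, h2⟩

/-- The assumptions in the definition of distality persist when the sequence is restricted to an
interval around the cut and a finite tuple of parameters is adjoined to its members. -/
theorem Ind.distalityAssumptions_append {c : K} (hc : IsDedekindAt c) {i j : K}
    (hij : c ∈ Set.Ioo i j) {A : Set M} {b : M} (h : Ind L A a (Set.Ioo i j))
    (hb : Ind L (A ∪ {b}) a (Set.Ioo i j \ {c})) {l : ℕ} {p : Fin l → M} (hp : ∀ v, p v ∈ A) :
    DistalityAssumptions L (⟨c, hij⟩ : Set.Ioo i j)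
      (fun k => Fin.append (a k) p) b := by
  refine distalityAssumptions_iff.2 ⟨hc.Ioo hij, ?_, ?_⟩
  · exact (h.mono (A := A ∪ ∅) (by simp) subset_rfl).append hp |>.comp
      (f := fun k : Set.Ioo i j => (k : K)) (fun _ _ h => h) (fun k _ => k.2)
  · exact hb.append hp |>.comp
      (f := fun k : Set.Ioo i j => (k : K)) (fun _ _ h => h)
      (fun k hk => ⟨k.2, fun h => hk (Subtype.ext h)⟩)

/-- To prove that all sequences satisfying the assumptions in the definition of distality remain
indiscernible over `b`, it suffices to consider the types of single members. -/
theorem indiscernibleOver_of_single {b : M}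
    (h : ∀ (K : Type u) [LinearOrder K] (c : K) (n : ℕ) (a : K → Fin n → M),
      DistalityAssumptions L c a b → ∃ c' ≠ c, EqTp L (Sum.elim (a c) (fun _ : Unit => b))
        (Sum.elim (a c') (fun _ : Unit => b)))
    {c : K} (hab : DistalityAssumptions L c a b) : IndiscernibleOver L {b} a := by
  obtain ⟨hc, h0, hb⟩ := distalityAssumptions_iff.1 hab
  -- Every increasing tuple of indices can be moved off `c` without changing its type over `b`; off
  -- `c` the sequence is indiscernible over `b` by assumption.
  have claim : ∀ (m : ℕ) (s : Fin m → K), StrictMono s → ∃ s' : Fin m → K, StrictMono s' ∧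
      (∀ q, s' q ≠ c) ∧
      EqTp L (Sum.elim (Subtype.val : ({b} : Set M) → M) (fun p : Fin m × Fin n => a (s p.1) p.2))
        (Sum.elim Subtype.val (fun p : Fin m × Fin n => a (s' p.1) p.2)) := by
    intro m s hs
    by_cases hsc : ∃ p, s p = c
    swap
    · exact ⟨s, hs, fun q hq => hsc ⟨q, hq⟩, fun φ => Iff.rfl⟩
    obtain ⟨p, hp⟩ := hsc
    -- The interval `(i, j)` is chosen to contain `c` but no other entry of `s`, so that the other
    -- entries become parameters.
    obtain ⟨i, hic, hi⟩ : ∃ i < c, ∀ q, s q < c → s q ≤ i := by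
      have : Nonempty (Set.Iio c) := hc.nonempty_left.elim fun i hi => ⟨⟨i, hi⟩⟩
      obtain ⟨i, hi⟩ := Finite.bddAbove_range
        (fun q : {q // s q < c} => (⟨s q, q.2⟩ : Set.Iio c))
      exact ⟨i, i.2, fun q hq => hi ⟨⟨q, hq⟩, rfl⟩⟩
    obtain ⟨j, hcj, hj⟩ : ∃ j > c, ∀ q, c < s q → j ≤ s q := by
      have : Nonempty (Set.Ioi c) := hc.nonempty_right.elim fun i hi => ⟨⟨i, hi⟩⟩
      obtain ⟨i, hi⟩ := Finite.bddBelow_range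
        (fun q : {q // c < s q} => (⟨s q, q.2⟩ : Set.Ioi c))
      exact ⟨i, i.2, fun q hq => hi ⟨⟨q, hq⟩, rfl⟩⟩
    have hcI : c ∈ Set.Ioo i j := ⟨hic, hcj⟩
    set O : Set M := components a (Set.Ioo i j)ᶜ with hO
    have h0' : Ind L O a (Set.Ioo i j) :=
      (h0.outside i j).mono (by rw [hO, Set.compl_eq_univ_sdiff]; exact Set.subset_union_right)
        (by simp)
    have hb' : Ind L (O ∪ {b}) a (Set.Ioo i j \ {c}) := by
      refine (hb.outside i j).mono ?_ (fun k hk => ⟨hk.2, hk.1⟩)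
      rintro x (⟨k, hk, v, rfl⟩ | hx)
      · exact Or.inr ⟨k, ⟨fun hkc => hk (hkc ▸ hcI), hk⟩, v, rfl⟩
      · exact Or.inl hx
    obtain ⟨c', hic', hc'c⟩ := hc.no_max_left i hic
    have hc'I : c' ∈ Set.Ioo i j := ⟨hic', hc'c.trans hcj⟩
    have main : EqTp L (Sum.elim (Subtype.val : ↥(O ∪ {b}) → M) (a c))
        (Sum.elim Subtype.val (a c')) := by
      refine EqTp.of_union fun l p hp => ?_
      -- The index `c''` supplied by `h` depends on `p`; it is replaced by the fixed `c'`, since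
      -- both lie off `c`.
      obtain ⟨⟨c'', hc''I⟩, hne, heq⟩ := h _ _ _ _ (h0'.distalityAssumptions_append hc hcI hb' hp)
      have heq' := hb'.single (k := c'') (k' := c') ⟨hc''I, fun h => hne (Subtype.ext h)⟩
        ⟨hc'I, hc'c.ne⟩
      refine EqTp.trans (y := Sum.elim Subtype.val (Sum.elim (a c'') p)) (heq.of_comp ?_)
        (heq'.of_comp ?_)
      · rintro (⟨x, rfl⟩ | v | v)
        · exact ⟨Sum.inr (), rfl, rfl⟩
        · exact ⟨Sum.inl (Fin.castAdd _ v), by simp, by simp⟩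
        · exact ⟨Sum.inl (Fin.natAdd _ v), by simp, by simp⟩
      · rintro (⟨x, rfl⟩ | v | v)
        · exact ⟨Sum.inl ⟨x, Or.inr rfl⟩, rfl, rfl⟩
        · exact ⟨Sum.inr v, rfl, rfl⟩
        · exact ⟨Sum.inl ⟨p v, Or.inl (hp v)⟩, rfl, rfl⟩
    have hout : ∀ q, q ≠ p → s q ∉ Set.Ioo i j := fun q hq hqI => by
      rcases lt_trichotomy (s q) c with hlt | heq | hgt
      · exact absurd hqI.1 (not_lt.2 (hi q hlt))
      · exact hq (hs.injective (heq.trans hp.symm))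
      · exact absurd hqI.2 (not_lt.2 (hj q hgt))
    refine ⟨Function.update s p c', ?_, ?_, ?_⟩
    · intro x y hxy
      by_cases hx : x = p
      · subst hx
        have hyx : y ≠ x := hxy.ne'
        simp only [Function.update_self, Function.update_of_ne hyx]
        exact hc'c.trans (hp ▸ hs hxy)
      · by_cases hy : y = p
        · subst hy
          simp only [Function.update_self, Function.update_of_ne hx]
          exact (hi x (hp ▸ hs hxy)).trans_lt hic'
        · simp only [Function.update_of_ne hx, Function.update_of_ne hy]
          exact hs hxy
    · intro q
      by_cases hq : q = p
      · subst hq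
        simpa using hc'c.ne
      · simp only [Function.update_of_ne hq]
        exact fun h => hout q hq (h ▸ hcI)
    · refine main.of_comp ?_
      rintro (⟨x, rfl⟩ | ⟨q, v⟩)
      · exact ⟨Sum.inl ⟨x, Or.inr rfl⟩, rfl, rfl⟩
      · by_cases hq : q = p
        · subst hq
          exact ⟨Sum.inr v, by simp [hp], by simp⟩
        · exact ⟨Sum.inl ⟨a (s q) v, Or.inl ⟨s q, hout q hq, v, rfl⟩⟩, rfl, by simp [hq]⟩
  rw [indiscernibleOver_iff]
  intro m s t hs ht _ _
  obtain ⟨s', hs', hsc, hss⟩ := claim m s hs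
  obtain ⟨t', ht', htc, htt⟩ := claim m t ht
  exact (hss.trans (hb m s' t' hs' ht' hsc htc)).trans htt.symm

end Ind

/-! ### Saturated dense linear orders -/

section SaturatedDLO

/-- For infinite `μ` there is a `μ`-saturated dense linear order of size at most `2 ^ μ`: the
eventually constant sequences of length `μ⁺` with three values, ordered lexicographically. -/
theorem exists_isSaturatedDLO (μ : Cardinal.{u}) (hμ : ℵ₀ ≤ μ) :
    ∃ (X : Type u) (_ : LinearOrder X), #X ≤ 2 ^ μ ∧ IsSaturatedDLO μ X := by
  classical
  let ι : Type u := (Order.succ μ).ord.ToType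
  have hreg := Cardinal.isRegular_succ hμ
  have hcof : Order.cof ι = Order.succ μ := by rw [Ordinal.cof_toType, hreg.cof_ord]
  let X : Type u := {f : Lex (ι → Fin 3) // ∃ α : ι, ∀ ξ, α ≤ ξ → f ξ = 1}
  have hbdd : ∀ s : Set ι, #s ≤ μ → ∃ α, ∀ ξ ∈ s, ξ ≤ α := fun s hs =>
    BddAbove.of_not_isCofinal fun h =>
      absurd ((hcof.symm.le.trans (Order.cof_le h)).trans hs) (not_le.2 (Order.lt_succ μ))
  have hlt : ∀ (x y : Lex (ι → Fin 3)) (α : ι), x ≤ y → (¬ ∀ ξ < α, x ξ = y ξ) →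
      ∃ ξ < α, (∀ η < ξ, x η = y η) ∧ x ξ < y ξ := by
    intro x y α hxy hne
    obtain ⟨ξ, h1, h2⟩ := lt_of_le_of_ne hxy (fun h => hne fun ξ _ => by rw [h])
    exact ⟨ξ, not_le.1 fun h => hne fun η hη => h1 η (hη.trans_le h), h1, h2⟩
  refine ⟨X, inferInstance, ?_, ?_⟩
  · let G : (Σ α : ι, (Set.Iio α → Fin 3)) → X := fun p =>
      ⟨toLex fun ξ => if h : ξ < p.1 then p.2 ⟨ξ, h⟩ else 1,
        p.1, fun ξ hξ => dif_neg (not_lt.2 hξ)⟩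
    have hG : Function.Surjective G := by
      rintro ⟨f, α, hf⟩
      refine ⟨⟨α, fun ξ => f ξ⟩, Subtype.ext (funext fun ξ => ?_)⟩
      by_cases h : ξ < α
      · exact dif_pos h
      · exact (dif_neg h).trans (hf ξ (not_lt.1 h)).symm
    refine (Cardinal.mk_le_of_surjective hG).trans ?_
    rw [Cardinal.mk_sigma]
    have h2μ : ℵ₀ ≤ 2 ^ μ := hμ.trans (Cardinal.cantor μ).le
    have hι : #ι ≤ 2 ^ μ := by
      rw [Cardinal.mk_ord_toType]
      exact Order.succ_le_of_lt (Cardinal.cantor μ)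
    calc Cardinal.sum (fun α : ι => #(Set.Iio α → Fin 3))
        ≤ Cardinal.sum (fun _ : ι => (2 : Cardinal.{u}) ^ μ) := by
          refine Cardinal.sum_le_sum _ _ fun α => ?_
          have hα : #(Set.Iio α) ≤ μ := Order.lt_succ_iff.1
            ((Cardinal.mk_Iio_lt α (by simp [ι])).trans_eq (Cardinal.mk_ord_toType _))
          calc #(Set.Iio α → Fin 3) = 3 ^ #(Set.Iio α) := by simp
            _ ≤ 3 ^ μ := Cardinal.power_le_power_left (by simp) hα
            _ = 2 ^ μ := Cardinal.power_eq_two_power hμ (by exact_mod_cast (by norm_num : 2 ≤ 3))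
              ((Cardinal.ofNat_lt_aleph0 (n := 3)).le.trans hμ)
      _ = #ι * 2 ^ μ := by simp
      _ ≤ 2 ^ μ * 2 ^ μ := mul_le_mul_left hι _
      _ = 2 ^ μ := Cardinal.mul_eq_self h2μ
  · intro A B hA hB hAB
    choose β hβ using fun x : X => x.2
    -- As `μ⁺` is regular, some `α` exists from which on all members of `A` and `B` are `1`.
    obtain ⟨α, hα⟩ := hbdd (β '' A ∪ β '' B) ((Cardinal.mk_union_le _ _).trans
      (((add_le_add Cardinal.mk_image_le Cardinal.mk_image_le).trans
        (add_le_add hA.le hB.le)).trans (Cardinal.add_eq_self hμ).le))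
    have hA1 : ∀ x ∈ A, ∀ ξ, α ≤ ξ → x.1 ξ = 1 := fun x hx ξ hξ =>
      hβ x ξ ((hα _ (Or.inl ⟨x, hx, rfl⟩)).trans hξ)
    have hB1 : ∀ x ∈ B, ∀ ξ, α ≤ ξ → x.1 ξ = 1 := fun x hx ξ hξ =>
      hβ x ξ ((hα _ (Or.inr ⟨x, hx, rfl⟩)).trans hξ)
    -- The supremum is taken among all sequences, so `g` need not belong to `X`. The points `f v`
    -- cut it off at `α`, where their value `v` can be placed below or above the value `1` shared by
    -- all of `A` and `B`.
    let g : Lex (ι → Fin 3) := sSup (Subtype.val '' A)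
    have hgA : ∀ x ∈ A, x.1 ≤ g := fun x hx => le_sSup ⟨x, hx, rfl⟩
    have hgB : ∀ x ∈ B, g ≤ x.1 := fun x hx => sSup_le (by
      rintro _ ⟨y, hy, rfl⟩
      exact (hAB y hy x hx).le)
    have hι : NoMaxOrder ι := by
      refine ⟨fun x => ?_⟩
      by_contra! hx
      have h1 : Order.cof ι ≤ #({x} : Set ι) := Order.cof_le fun y => ⟨x, rfl, hx y⟩
      rw [hcof, Cardinal.mk_singleton] at h1
      exact absurd (h1.trans (Cardinal.one_lt_aleph0.le.trans hμ)) (not_le.2 (Order.lt_succ μ))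
    let f : Fin 3 → X := fun v =>
      ⟨toLex fun ξ => if ξ < α then g ξ else if ξ = α then v else 1, by
        obtain ⟨α', hα'⟩ := exists_gt α
        exact ⟨α', fun ξ hξ => by
          have h := hα'.trans_le hξ
          simp [h.not_gt, h.ne']⟩⟩
    have hf1 : ∀ v ξ, ξ < α → (f v).1 ξ = g ξ := fun v ξ h => if_pos h
    have hf2 : ∀ v, (f v).1 α = v := fun v => (if_neg (lt_irrefl _)).trans (if_pos rfl)
    -- If some `b ∈ B` agrees with `g` below `α`, then no member of `A` does, as it would equal `b`;
    -- hence `f 0` fits. Otherwise every member of `B` exceeds `g` already below `α`, and `f 2`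
    -- fits.
    by_cases h : ∃ b ∈ B, ∀ ξ < α, b.1 ξ = g ξ
    · obtain ⟨b, hb, hbg⟩ := h
      have hfb : f 0 < b := ⟨α, fun ξ hξ => (hf1 0 ξ hξ).trans (hbg ξ hξ).symm, by
        show (f 0).1 α < b.1 α
        rw [hf2, hB1 b hb α le_rfl]
        decide⟩
      refine ⟨f 0, fun a ha => ?_, fun b' hb' => ?_⟩
      · obtain ⟨ξ, hξ, h1, h2⟩ := hlt a.1 g α (hgA a ha) (fun h => by
          refine (hAB a ha b hb).ne (Subtype.ext (funext fun ξ => ?_))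
          rcases lt_or_ge ξ α with hξ | hξ
          · exact (h ξ hξ).trans (hbg ξ hξ).symm
          · rw [hA1 a ha ξ hξ, hB1 b hb ξ hξ])
        refine ⟨ξ, fun η hη => (h1 η hη).trans (hf1 0 η (hη.trans hξ)).symm, ?_⟩
        show a.1 ξ < (f 0).1 ξ
        rwa [hf1 0 ξ hξ]
      · refine hfb.trans_le ?_
        by_cases h : ∀ ξ < α, g ξ = b'.1 ξ
        · refine le_of_eq (Subtype.ext (funext fun ξ => ?_))
          rcases lt_or_ge ξ α with hξ | hξ
          · exact (hbg ξ hξ).trans (h ξ hξ)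
          · rw [hB1 b hb ξ hξ, hB1 b' hb' ξ hξ]
        · obtain ⟨ξ, hξ, h1, h2⟩ := hlt g b'.1 α (hgB b' hb') h
          refine le_of_lt ⟨ξ, fun η hη => (hbg η (hη.trans hξ)).trans (h1 η hη), ?_⟩
          show b.1 ξ < b'.1 ξ
          rwa [hbg ξ hξ]
    · push Not at h
      refine ⟨f 2, fun a ha => ?_, fun b hb => ?_⟩
      · by_cases hag : ∀ ξ < α, a.1 ξ = g ξ
        · refine ⟨α, fun ξ hξ => (hag ξ hξ).trans (hf1 2 ξ hξ).symm, ?_⟩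
          show a.1 α < (f 2).1 α
          rw [hf2, hA1 a ha α le_rfl]
          decide
        · obtain ⟨ξ, hξ, h1, h2⟩ := hlt a.1 g α (hgA a ha) hag
          refine ⟨ξ, fun η hη => (h1 η hη).trans (hf1 2 η (hη.trans hξ)).symm, ?_⟩
          show a.1 ξ < (f 2).1 ξ
          rwa [hf1 2 ξ hξ]
      · obtain ⟨ξ, hξ, h1, h2⟩ := hlt g b.1 α (hgB b hb) (fun h' => by
          obtain ⟨ξ, hξ, hne⟩ := h b hb
          exact hne (h' ξ hξ).symm)
        refine ⟨ξ, fun η hη => (hf1 2 η (hη.trans hξ)).trans (h1 η hη), ?_⟩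
        show (f 2).1 ξ < b.1 ξ
        rwa [hf1 2 ξ hξ]

theorem IsSaturatedDLO.exists_between {μ : Cardinal.{u}} (hμ : ℵ₀ ≤ μ) {X : Type u} [LinearOrder X]
    (h : IsSaturatedDLO μ X) {x y : X} (hxy : x < y) : ∃ z, x < z ∧ z < y := by
  have h1 : ∀ w : X, #({w} : Set X) < μ := fun w => by
    rw [Cardinal.mk_singleton]
    exact Cardinal.one_lt_aleph0.trans_le hμ
  obtain ⟨z, hz1, hz2⟩ := h {x} {y} (h1 x) (h1 y) (by simpa using hxy)
  exact ⟨z, hz1 x rfl, hz2 y rfl⟩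

theorem IsSaturatedDLO.isDedekindAt {μ : Cardinal.{u}} (hμ : ℵ₀ ≤ μ) {X : Type u} [LinearOrder X]
    (h : IsSaturatedDLO μ X) (c : X) : IsDedekindAt c where
  nonempty_left := by
    obtain ⟨x, -, hx⟩ := h ∅ {c} (by simpa using Cardinal.aleph0_pos.trans_le hμ)
      (by simpa using Cardinal.one_lt_aleph0.trans_le hμ) (by simp)
    exact ⟨x, hx c rfl⟩
  nonempty_right := by
    obtain ⟨x, hx, -⟩ := h {c} ∅ (by simpa using Cardinal.one_lt_aleph0.trans_le hμ)
      (by simpa using Cardinal.aleph0_pos.trans_le hμ) (by simp)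
    exact ⟨x, hx c rfl⟩
  no_max_left _ hi := h.exists_between hμ hi
  no_min_right _ hj := h.exists_between hμ hj

theorem mk_insert_lt {α : Type u} {s : Set α} {x : α} {μ : Cardinal.{u}} (hμ : ℵ₀ ≤ μ)
    (hs : #s < μ) : #(insert x s : Set α) < μ :=
  Cardinal.mk_insert_le.trans_lt
    (Cardinal.add_lt_of_lt hμ hs (Cardinal.one_lt_aleph0.trans_le hμ))

theorem IsSaturatedDLO.Iio {μ : Cardinal.{u}} (hμ : ℵ₀ ≤ μ) {X : Type u} [LinearOrder X]
    (h : IsSaturatedDLO μ X) (c : X) : IsSaturatedDLO μ (Set.Iio c) := by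
  intro A B hA hB hAB
  obtain ⟨x, hx1, hx2⟩ := h (Subtype.val '' A) (insert c (Subtype.val '' B))
    (Cardinal.mk_image_le.trans_lt hA) (mk_insert_lt hμ (Cardinal.mk_image_le.trans_lt hB)) (by
      rintro _ ⟨a, ha, rfl⟩ _ (rfl | ⟨b, hb, rfl⟩)
      · exact a.2
      · exact hAB a ha b hb)
  exact ⟨⟨x, hx2 c (Or.inl rfl)⟩, fun a ha => hx1 a ⟨a, ha, rfl⟩,
    fun b hb => hx2 b (Or.inr ⟨b, hb, rfl⟩)⟩

theorem IsSaturatedDLO.Ioi {μ : Cardinal.{u}} (hμ : ℵ₀ ≤ μ) {X : Type u} [LinearOrder X]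
    (h : IsSaturatedDLO μ X) (c : X) : IsSaturatedDLO μ (Set.Ioi c) := by
  intro A B hA hB hAB
  obtain ⟨x, hx1, hx2⟩ := h (insert c (Subtype.val '' A)) (Subtype.val '' B)
    (mk_insert_lt hμ (Cardinal.mk_image_le.trans_lt hA)) (Cardinal.mk_image_le.trans_lt hB) (by
      rintro _ (rfl | ⟨a, ha, rfl⟩) _ ⟨b, hb, rfl⟩
      · exact b.2
      · exact hAB a ha b hb)
  exact ⟨⟨x, hx1 c (Or.inl rfl)⟩, fun a ha => hx1 a (Or.inr ⟨a, ha, rfl⟩),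
    fun b hb => hx2 b ⟨b, hb, rfl⟩⟩

theorem IsSaturatedDLO.of_orderIso {μ : Cardinal.{u}} {X Y : Type u} [LinearOrder X]
    [LinearOrder Y] (h : IsSaturatedDLO μ X) (e : X ≃o Y) : IsSaturatedDLO μ Y := by
  intro A B hA hB hAB
  obtain ⟨x, hx1, hx2⟩ := h (e.symm '' A) (e.symm '' B)
    (Cardinal.mk_image_le.trans_lt hA) (Cardinal.mk_image_le.trans_lt hB) (by
      rintro _ ⟨a, ha, rfl⟩ _ ⟨b, hb, rfl⟩
      exact e.symm.lt_iff_lt.2 (hAB a ha b hb))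
  exact ⟨e x, fun a ha => e.symm_apply_lt.1 (hx1 _ ⟨a, ha, rfl⟩),
    fun b hb => e.lt_symm_apply.1 (hx2 _ ⟨b, hb, rfl⟩)⟩

theorem isSaturatedDLO_Iio_Ioo {μ : Cardinal.{u}} (hμ : ℵ₀ ≤ μ) {K : Type u} [LinearOrder K]
    {c i j : K} (h : IsSaturatedDLO μ (Set.Iio c)) (hc : c ∈ Set.Ioo i j) :
    IsSaturatedDLO μ (Set.Iio (⟨c, hc⟩ : Set.Ioo i j)) :=
  (h.Ioi hμ ⟨i, hc.1⟩).of_orderIso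
    { toFun := fun x => ⟨⟨x.1.1, x.2, lt_trans x.1.2 hc.2⟩, x.1.2⟩
      invFun := fun x => ⟨⟨x.1.1, x.2⟩, x.1.2.1⟩
      left_inv := fun _ => rfl
      right_inv := fun _ => rfl
      map_rel_iff' := Iff.rfl }

theorem isSaturatedDLO_Ioi_Ioo {μ : Cardinal.{u}} (hμ : ℵ₀ ≤ μ) {K : Type u} [LinearOrder K]
    {c i j : K} (h : IsSaturatedDLO μ (Set.Ioi c)) (hc : c ∈ Set.Ioo i j) :
    IsSaturatedDLO μ (Set.Ioi (⟨c, hc⟩ : Set.Ioo i j)) :=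
  (h.Iio hμ ⟨j, hc.2⟩).of_orderIso
    { toFun := fun x => ⟨⟨x.1.1, lt_trans hc.1 x.1.2, x.2⟩, x.1.2⟩
      invFun := fun x => ⟨⟨x.1.1, x.2⟩, x.1.2.2⟩
      left_inv := fun _ => rfl
      right_inv := fun _ => rfl
      map_rel_iff' := Iff.rfl }

end SaturatedDLO

/-! ### Transfer from arbitrary models to a saturated one -/

section Transfer

variable {L : FirstOrder.Language.{u, u}} {M N : Type u} [L.Structure M] [L.Structure N]

/-- In a `κ`-saturated structure, every limit of types of tuples of fewer than `κ` elements of an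
elementarily equivalent structure is realized. -/
theorem exists_realize_ultrafilter (hMN : ∀ φ : L.Sentence, M ⊨ φ ↔ N ⊨ φ) {κ : Cardinal.{u}}
    (hsat : IsSaturated L N κ) {V : Type u} (hV : #V < κ) {ι : Type*} (U : Ultrafilter ι)
    (x : ι → V → M) :
    ∃ y : V → N, ∀ φ : L.Formula V, φ.Realize y ↔ ∀ᶠ F in U, φ.Realize (x F) := by
  classical
  -- Zorn's lemma is applied to graphs realizing the limit type on their pairs. That they are
  -- functional need not be required, since the formulas include equality.
  let P : Set (Set (V × N)) := {G | ∀ φ : L.Formula G, φ.Realize (fun g => g.1.2) ↔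
    ∀ᶠ F in U, φ.Realize (fun g => x F g.1.1)}
  -- Elementary equivalence is needed only here; later steps deduce existential formulas from the
  -- graph already built.
  have hempty : ∅ ∈ P := by
    intro φ
    have key : ∀ {M' : Type u} [L.Structure M'] (z : (∅ : Set (V × N)) → M'),
        φ.Realize z ↔ M' ⊨ (φ.relabel (fun g => g.2.elim) : L.Sentence) := fun z => by
      unfold FirstOrder.Language.Sentence.Realize
      rw [FirstOrder.Language.Formula.realize_relabel]
      exact iff_of_eq (congrArg _ (funext fun g => g.2.elim))
    simp only [key, hMN, Filter.eventually_const]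
  obtain ⟨G, hG⟩ := zorn_subset P fun C hC hchain => by
    rcases C.eq_empty_or_nonempty with rfl | hne
    · exact ⟨∅, hempty, by simp⟩
    refine ⟨⋃₀ C, fun φ => ?_, fun s hs => Set.subset_sUnion_of_mem hs⟩
    let S : Set (V × N) := Subtype.val '' (φ.freeVarFinset : Set ↥(⋃₀ C))
    obtain ⟨G, hGC, hSG⟩ : ∃ G ∈ C, S ⊆ G :=
      DirectedOn.exists_mem_subset_of_finite_of_subset_sUnion hne hchain.directedOn
        (φ.freeVarFinset.finite_toSet.image _) (by rintro _ ⟨g, -, rfl⟩; exact g.2)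
    let f : φ.freeVarFinset → G := fun g => ⟨g.1, hSG ⟨g.1, g.2, rfl⟩⟩
    have h1 := hC hGC (FirstOrder.Language.BoundedFormula.restrictFreeVar φ f)
    have key : ∀ {M' : Type u} [L.Structure M'] (z : V × N → M'),
        FirstOrder.Language.Formula.Realize
          (FirstOrder.Language.BoundedFormula.restrictFreeVar φ f) (fun g : G => z g) ↔
          φ.Realize (fun g => z g) := fun z =>
      FirstOrder.Language.BoundedFormula.realize_restrictFreeVar _ (fun g => rfl)
    rw [key (fun g => g.2)] at h1
    exact h1.trans (Filter.eventually_congr (.of_forall fun F => key (fun g => x F g.1)))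
  have hGP : G ∈ P := hG.prop
  have hfun : ∀ v n n', (v, n) ∈ G → (v, n') ∈ G → n = n' := fun v n n' h h' => by
    have := hGP ((FirstOrder.Language.Term.var ⟨_, h⟩).equal (FirstOrder.Language.Term.var ⟨_, h'⟩))
    simpa using this
  have hdom : ∀ v, ∃ n, (v, n) ∈ G := by
    intro v
    let A : Set N := Prod.snd '' G
    have hA : #A < κ := by
      refine lt_of_le_of_lt ?_ hV
      have : ∀ n : A, ∃ v, (v, n.1) ∈ G := by
        rintro ⟨_, ⟨w, n⟩, h, rfl⟩
        exact ⟨w, h⟩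
      choose f hf using this
      exact Cardinal.mk_le_of_injective (f := f) fun n n' h =>
        Subtype.ext (hfun (f n) _ _ (hf n) (h ▸ hf n'))
    let conv : L.Formula (G ⊕ Unit) → L[[A]].Formula Unit := fun θ =>
      FirstOrder.Language.BoundedFormula.constantsVarsEquiv.symm
        (FirstOrder.Language.Formula.relabel
          (Sum.map (fun g : G => (⟨g.1.2, g.1, g.2, rfl⟩ : A)) id) θ)
    have hconv : ∀ θ z, (conv θ).Realize (fun _ => z) ↔
        θ.Realize (Sum.elim (fun g : G => g.1.2) (fun _ => z)) := fun θ z => by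
      rw [← realize_constantsVarsEquiv_iff, Equiv.apply_symm_apply,
        FirstOrder.Language.Formula.realize_relabel, Sum.elim_comp_map]
      rfl
    obtain ⟨z, hz⟩ := hsat A hA
      (conv '' {θ | ∀ᶠ F in U, θ.Realize (Sum.elim (fun g : G => x F g.1.1) (fun _ => x F v))}) (by
      intro q hq
      choose θ hθ hθq using fun ψ : q => hq ψ.2
      -- Finite satisfiability: the existential closure of a finite conjunction of limit formulas
      -- holds along `U`, with witness `x F v`, so it holds in `N` because `G ∈ P`.
      have h1 := hGP ((FirstOrder.Language.Formula.iInf θ).iExs Unit)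
      simp only [FirstOrder.Language.Formula.realize_iExs,
        FirstOrder.Language.Formula.realize_iInf] at h1
      obtain ⟨z, hz⟩ := h1.2 ((Filter.eventually_all.2 hθ).mono fun F hF => ⟨_, hF⟩)
      refine ⟨z (), fun φ hφ => ?_⟩
      have h2 := (hconv (θ ⟨φ, hφ⟩) (z ())).2 (hz ⟨φ, hφ⟩)
      rwa [hθq] at h2)
    refine ⟨z, hG.le_of_ge (y := insert (v, z) G) ?_ (Set.subset_insert _ _)
      (Set.mem_insert _ _)⟩
    intro φ
    let f : ↥(insert (v, z) G) → G ⊕ Unit := fun g =>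
      if h : g.1 ∈ G then Sum.inl ⟨g.1, h⟩ else Sum.inr ()
    have key : ∀ {M' : Type u} [L.Structure M'] (w : V × N → M'),
        (φ.relabel f).Realize (Sum.elim (fun g : G => w g) (fun _ => w (v, z))) ↔
          φ.Realize (fun g => w g) := fun w => by
      rw [FirstOrder.Language.Formula.realize_relabel]
      refine iff_of_eq (congrArg _ (funext fun g => ?_))
      by_cases h : g.1 ∈ G
      · simp [f, h]
      · have hf : f g = Sum.inr () := dif_neg h
        rw [Function.comp_apply, hf, g.2.resolve_right h, Sum.elim_inr]
    have hev : ∀ θ : L.Formula (G ⊕ Unit),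
        (∀ᶠ F in U, θ.Realize (Sum.elim (fun g : G => x F g.1.1) (fun _ => x F v))) →
          θ.Realize (Sum.elim (fun g : G => g.1.2) (fun _ => z)) := fun θ hθ =>
      (hconv θ z).1 (hz _ ⟨θ, hθ, rfl⟩)
    rw [← key (fun g => g.2),
      ← Filter.eventually_congr (.of_forall fun F => key (fun g => x F g.1))]
    refine ⟨fun h => ?_, hev _⟩
    by_contra hcon
    have := hev (∼(φ.relabel f)) (by
      rw [← Ultrafilter.eventually_not] at hcon
      exact hcon.mono fun F hF => FirstOrder.Language.Formula.realize_not.2 hF)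
    exact FirstOrder.Language.Formula.realize_not.1 this h
  choose y hy using hdom
  refine ⟨y, fun φ => ?_⟩
  have := hGP (φ.relabel fun v => ⟨(v, y v), hy v⟩)
  simpa only [FirstOrder.Language.Formula.realize_relabel, Function.comp_def] using this

/-- There is an increasing `ω`-sequence below `c` and a decreasing one above it. A point below
(above) `c₀` is sent to the term indexed by the number of elements of `F` below (above) it. Off `F`
monotonicity may fail, but `c` is still avoided. -/
theorem IsDedekindAt.exists_strictMonoOn {K X : Type u} [LinearOrder K] [LinearOrder X] {c : K}
    (h : IsDedekindAt c) (c₀ : X) (F : Finset X) :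
    ∃ e : X → K, e c₀ = c ∧ StrictMonoOn e F ∧ ∀ x, x ≠ c₀ → e x ≠ c := by
  classical
  have : Nonempty (Set.Iio c) := h.nonempty_left.elim fun i hi => ⟨⟨i, hi⟩⟩
  have : Nonempty (Set.Ioi c) := h.nonempty_right.elim fun i hi => ⟨⟨i, hi⟩⟩
  have : NoMaxOrder (Set.Iio c) := ⟨fun x => by
    obtain ⟨y, h1, h2⟩ := h.no_max_left x x.2
    exact ⟨⟨y, h2⟩, h1⟩⟩
  have : NoMinOrder (Set.Ioi c) := ⟨fun x => by
    obtain ⟨y, h1, h2⟩ := h.no_min_right x x.2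
    exact ⟨⟨y, h1⟩, h2⟩⟩
  obtain ⟨f, hf⟩ := Nat.exists_strictMono (Set.Iio c)
  obtain ⟨g, hg⟩ := Nat.exists_strictAnti (Set.Ioi c)
  let e : X → K := fun x => if x < c₀ then f (F.filter (· < x)).card else
    if c₀ < x then g (F.filter (x < ·)).card else c
  have e1 : ∀ x, x < c₀ → e x = f (F.filter (· < x)).card := fun x hx => if_pos hx
  have e2 : ∀ x, c₀ < x → e x = g (F.filter (x < ·)).card := fun x hx =>
    (if_neg hx.not_gt).trans (if_pos hx)
  have e3 : e c₀ = c := by simp [e]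
  have l1 : ∀ x, x < c₀ → e x < c := fun x hx => by rw [e1 x hx]; exact (f _).2
  have l2 : ∀ x, c₀ < x → c < e x := fun x hx => by rw [e2 x hx]; exact (g _).2
  refine ⟨e, e3, fun x hx y hy hxy => ?_, fun x hx => ?_⟩
  · rcases lt_trichotomy x c₀ with hxc | rfl | hxc
    · rcases lt_trichotomy y c₀ with hyc | rfl | hyc
      · rw [e1 x hxc, e1 y hyc]
        refine hf (Finset.card_lt_card (Finset.ssubset_iff_of_subset ?_ |>.2 ⟨x, ?_, ?_⟩))
        · exact fun z hz => by
            simp only [Finset.mem_filter] at hz ⊢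
            exact ⟨hz.1, hz.2.trans hxy⟩
        · simpa using ⟨hx, hxy⟩
        · simp
      · rw [e3]
        exact l1 x hxc
      · exact (l1 x hxc).trans (l2 y hyc)
    · rw [e3]
      exact l2 y hxy
    · have hyc := hxc.trans hxy
      rw [e2 x hxc, e2 y hyc]
      refine hg (Finset.card_lt_card (Finset.ssubset_iff_of_subset ?_ |>.2 ⟨y, ?_, ?_⟩))
      · exact fun z hz => by
          simp only [Finset.mem_filter] at hz ⊢
          exact ⟨hz.1, hxy.trans hz.2⟩
      · simpa using ⟨hy, hxy⟩
      · simp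
  · rcases lt_or_gt_of_ne hx with h | h
    · exact (l1 x h).ne
    · exact (l2 x h).ne'

/-- To prove that a `κ`-saturated structure is distal, it suffices to consider sequences in it which
are indexed by a given Dedekind cut in an order of size less than `κ`, and the types of single
members of the sequences. -/
theorem isDistal_of_isSaturated {κ : Cardinal.{u}} (hκ : ℵ₀ ≤ κ) (hsat : IsSaturated L N κ)
    (X : Type u) [LinearOrder X] (hX : #X < κ) {c₀ : X} (hc₀ : IsDedekindAt c₀)
    (h : ∀ (n : ℕ) (a : X → Fin n → N) (b : N), DistalityAssumptions L c₀ a b →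
      ∃ c' ≠ c₀, EqTp L (Sum.elim (a c₀) (fun _ : Unit => b))
        (Sum.elim (a c') (fun _ : Unit => b))) :
    IsDistal L N := by
  classical
  intro M _ hM K _ c n a b hab
  have hMN : ∀ φ : L.Sentence, M ⊨ φ ↔ N ⊨ φ :=
    FirstOrder.Language.realize_iff_of_model_completeTheory N M
  refine indiscernibleOver_of_single (fun K _ c n a hab => ?_) hab
  obtain ⟨hc, h0, hb⟩ := distalityAssumptions_iff.1 hab
  choose e he1 he2 he3 using hc.exists_strictMonoOn c₀
  let V : Type u := (X × Fin n) ⊕ Unit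
  have hV : #V < κ := by
    simp only [V, Cardinal.mk_sum, Cardinal.mk_prod, Cardinal.lift_uzero, Cardinal.mk_fin,
      Cardinal.lift_natCast]
    exact Cardinal.add_lt_of_lt hκ (Cardinal.mul_lt_of_lt hκ hX
      ((Cardinal.natCast_lt_aleph0 (n := n)).trans_le hκ))
      (by simpa using Cardinal.one_lt_aleph0.trans_le hκ)
  -- The new sequence is the limit of the copies of `a` along the maps `e F`, which are eventually
  -- increasing on any given finite set.
  let x : Finset X → V → M := fun F => Sum.elim (fun p => a (e F p.1) p.2) (fun _ => b)
  let U : Ultrafilter (Finset X) := Ultrafilter.of Filter.atTop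
  have hU : ∀ F₀ : Finset X, ∀ᶠ F in U, F₀ ⊆ F := fun F₀ =>
    (Filter.eventually_ge_atTop F₀).filter_mono (Ultrafilter.of_le _)
  obtain ⟨y, hy⟩ := exists_realize_ultrafilter hMN hsat hV U x
  have hy' : ∀ {β : Type u} (f : β → V) (φ : L.Formula β),
      φ.Realize (y ∘ f) ↔ ∀ᶠ F in U, φ.Realize (x F ∘ f) := fun f φ => by
    simpa only [FirstOrder.Language.Formula.realize_relabel] using hy (φ.relabel f)
  have htp : ∀ {β : Type u} (f g : β → V), (∀ᶠ F in U, EqTp L (x F ∘ f) (x F ∘ g)) →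
      EqTp L (y ∘ f) (y ∘ g) := fun f g hfg φ => by
    rw [hy', hy']
    exact Filter.eventually_congr (hfg.mono fun F hF => hF φ)
  have hmono : ∀ (m : ℕ) (s : Fin m → X), StrictMono s → ∀ᶠ F in U,
      StrictMono fun i => e F (s i) := fun m s hs =>
    (hU (Finset.univ.image s)).mono fun F hF i j hij =>
      he2 F (hF (Finset.mem_image_of_mem s (Finset.mem_univ i)))
        (hF (Finset.mem_image_of_mem s (Finset.mem_univ j))) (hs hij)
  let a' : X → Fin n → N := fun k v => y (Sum.inl (k, v))
  let b' : N := y (Sum.inr ())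
  have hab' : DistalityAssumptions L c₀ a' b' := by
    refine distalityAssumptions_iff.2 ⟨hc₀, ?_, ?_⟩
    · intro m s t hs ht _ _
      refine EqTp.of_comp (htp (β := ULift (Fin m × Fin n)) (fun p => Sum.inl (s p.down.1, p.down.2))
        (fun p => Sum.inl (t p.down.1, p.down.2)) ?_) ?_
      · filter_upwards [hmono m s hs, hmono m t ht] with F hFs hFt
        exact (h0 m _ _ hFs hFt (fun _ => trivial) (fun _ => trivial)).of_comp
          fun p => ⟨Sum.inr p.down, rfl, rfl⟩
      · rintro (z | p)
        · exact z.2.elim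
        · exact ⟨⟨p⟩, rfl, rfl⟩
    · intro m s t hs ht hsc htc
      refine EqTp.of_comp (htp (β := ULift (Unit ⊕ Fin m × Fin n))
        (fun p => p.down.elim Sum.inr fun p => Sum.inl (s p.1, p.2))
        (fun p => p.down.elim Sum.inr fun p => Sum.inl (t p.1, p.2)) ?_) ?_
      · filter_upwards [hmono m s hs, hmono m t ht] with F hFs hFt
        refine (hb m _ _ hFs hFt (fun i => he3 F _ (hsc i)) (fun i => he3 F _ (htc i))).of_comp ?_
        rintro ⟨z | p⟩
        · exact ⟨Sum.inl ⟨b, rfl⟩, rfl, rfl⟩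
        · exact ⟨Sum.inr p, rfl, rfl⟩
      · rintro (⟨z, rfl⟩ | p)
        · exact ⟨⟨Sum.inl ()⟩, rfl, rfl⟩
        · exact ⟨⟨Sum.inr p⟩, rfl, rfl⟩
  obtain ⟨c', hc', heq⟩ := h n a' b' hab'
  obtain ⟨k, hkc⟩ := hc.nonempty_left
  refine ⟨k, hkc.ne, fun φ => ?_⟩
  let f : X → Fin n ⊕ Unit → V := fun k => Sum.map (fun v => (k, v)) id
  have hyf : ∀ k, y ∘ f k = Sum.elim (a' k) (fun _ => b') := fun k => by
    funext z
    rcases z with v | z <;> rfl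
  have hxf : ∀ F k, x F ∘ f k = Sum.elim (a (e F k)) (fun _ => b) := fun F k => by
    funext z
    rcases z with v | z <;> rfl
  have htp' : ∀ k k', k ≠ c → k' ≠ c → EqTp L (Sum.elim (a k) (fun _ : Unit => b))
      (Sum.elim (a k') (fun _ : Unit => b)) := fun k k' hk hk' => by
    refine (hb.single hk hk').of_comp ?_
    rintro (v | z)
    · exact ⟨Sum.inr v, rfl, rfl⟩
    · exact ⟨Sum.inl ⟨b, rfl⟩, rfl, rfl⟩
  have h1 : ∀ k, φ.Realize (Sum.elim (a' k) (fun _ => b')) ↔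
      ∀ᶠ F in U, φ.Realize (Sum.elim (a (e F k)) (fun _ => b)) := fun k => by
    have := hy ((φ.relabel (f k)))
    simpa only [FirstOrder.Language.Formula.realize_relabel, hyf, hxf] using this
  have h2 := heq φ
  rw [h1, h1] at h2
  simp only [he1, Filter.eventually_const] at h2
  rw [h2]
  -- The index `e F c'` varies with `F` but never equals `c`, so indiscernibility over `b` off `c`
  -- makes the truth value constant.
  have h3 : ∀ F, φ.Realize (Sum.elim (a (e F c')) (fun _ => b)) ↔
      φ.Realize (Sum.elim (a k) (fun _ => b)) := fun F => htp' _ _ (he3 F c' hc') hkc.ne φ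
  simp only [h3, Filter.eventually_const]

end Transfer

/-! ### Automorphisms of the monster model -/

section Monster

variable {L : FirstOrder.Language.{u, u}} {N : Type u} [L.Structure N]

theorem EqTp.exists_equiv {κ : Cardinal.{u}} (hhom : IsStronglyHomogeneous L N κ) {α : Type u}
    (hα : #α < κ) {x y : α → N} (h : EqTp L x y) : ∃ σ : N ≃[L] N, ∀ i, σ (x i) = y i :=
  hhom α x y hα (sameType_empty_iff.2 h)

theorem Ind.exists_equiv {κ : Cardinal.{u}} (hκ : ℵ₀ ≤ κ) (hhom : IsStronglyHomogeneous L N κ)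
    {A : Set N} (hA : #A < κ) {K : Type u} [LinearOrder K] {n : ℕ} {a : K → Fin n → N} {S : Set K}
    (h : Ind L A a S) {m : ℕ} {s t : Fin m → K} (hs : StrictMono s) (ht : StrictMono t)
    (hsS : ∀ i, s i ∈ S) (htS : ∀ i, t i ∈ S) :
    ∃ σ : N ≃[L] N, (∀ x ∈ A, σ x = x) ∧ ∀ i v, σ (a (s i) v) = a (t i) v := by
  obtain ⟨σ, hσ⟩ := (h m s t hs ht hsS htS).exists_equiv hhom (by
    rw [Cardinal.mk_sum]
    exact Cardinal.add_lt_of_lt hκ (by simpa using hA) ((Cardinal.lift_lt_aleph0.2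
      (Cardinal.lt_aleph0_of_finite _)).trans_le hκ))
  exact ⟨σ, fun x hx => hσ (Sum.inl ⟨x, hx⟩), fun i v => hσ (Sum.inr (i, v))⟩

theorem Ind.exists_equiv_single {κ : Cardinal.{u}} (hκ : ℵ₀ ≤ κ)
    (hhom : IsStronglyHomogeneous L N κ)
    {A : Set N} (hA : #A < κ) {K : Type u} [LinearOrder K] {n : ℕ} {a : K → Fin n → N} {S : Set K}
    (h : Ind L A a S) {k k' : K} (hk : k ∈ S) (hk' : k' ∈ S) :
    ∃ σ : N ≃[L] N, (∀ x ∈ A, σ x = x) ∧ ∀ v, σ (a k v) = a k' v := by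
  obtain ⟨σ, h1, h2⟩ := h.exists_equiv hκ hhom hA (m := 1) (s := fun _ => k) (t := fun _ => k')
    (Subsingleton.strictMono _) (Subsingleton.strictMono _) (fun _ => hk) (fun _ => hk')
  exact ⟨σ, h1, h2 0⟩

/-- A sequence is indiscernible over `A` if automorphisms over `A` witness it. -/
theorem Ind.of_equiv {A : Set N} {K : Type u} [LinearOrder K] {n : ℕ} {a : K → Fin n → N}
    {S : Set K}
    (h : ∀ (m : ℕ) (s t : Fin m → K), StrictMono s → StrictMono t → (∀ i, s i ∈ S) →
      (∀ i, t i ∈ S) → ∃ σ : N ≃[L] N, (∀ x ∈ A, σ x = x) ∧ ∀ i v, σ (a (s i) v) = a (t i) v) :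
    Ind L A a S := by
  intro m s t hs ht hsS htS
  obtain ⟨σ, h1, h2⟩ := h m s t hs ht hsS htS
  refine EqTp.of_equiv σ ?_
  rintro (x | p)
  · exact h1 x x.2
  · exact h2 _ _

theorem EqTp.reduct {L' : FirstOrder.Language.{u, u}} [L'.Structure N] (Φ : L →ᴸ L')
    [Φ.IsExpansionOn N] {α : Type*} {x y : α → N} (h : EqTp L' x y) : EqTp L x y := fun φ => by
  rw [← Φ.realize_onFormula φ, ← Φ.realize_onFormula φ]
  exact h _

theorem mem_iff_of_definable {α : Type*} {D : Set (α → N)} (hD : (∅ : Set N).Definable L D)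
    (σ : N ≃[L] N) (x : α → N) : (fun i => σ (x i)) ∈ D ↔ x ∈ D := by
  obtain ⟨φ, rfl⟩ := Set.empty_definable_iff.1 hD
  exact FirstOrder.Language.StrongHomClass.realize_formula σ φ

variable (L) in
/-- The operation `f` commutes with all automorphisms. -/
def OpInvariant (f : Op N) : Prop :=
  ∀ (σ : N ≃[L] N) (x : Fin f.1 → N), σ (f.2 x) = f.2 (fun i => σ (x i))

theorem OpDefinable.opInvariant {f : Op N} (hf : OpDefinable L f) : OpInvariant L f := by
  intro σ x
  have h := (mem_iff_of_definable hf σ (Fin.snoc x (f.2 x))).2 (by simp)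
  simpa using h

theorem OpDefinable.map_expansion {L' : FirstOrder.Language.{u, u}} [L'.Structure N]
    (Φ : L →ᴸ L') [Φ.IsExpansionOn N] {f : Op N} (hf : OpDefinable L f) : OpDefinable L' f :=
  Set.Definable.map_expansion hf Φ

end Monster

section Restriction

variable {L LR : FirstOrder.Language.{u, u}} {N : Type u} [L.Structure N] [unaryLang.Structure N]
  [LR.Structure (predSet N)]

theorem mem_predSet_iff (σ : N ≃[withPred L] N) (x : N) : σ x ∈ predSet N ↔ x ∈ predSet N := by
  have h : FirstOrder.Language.Structure.RelMap (L := unaryLang) UnaryRel.mem (σ ∘ ![x]) ↔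
      FirstOrder.Language.Structure.RelMap (L := unaryLang) UnaryRel.mem ![x] :=
    σ.map_rel (Sum.inr UnaryRel.mem : (withPred L).Relations 1) ![x]
  have h' : σ ∘ ![x] = ![σ x] := by
    funext i
    fin_cases i
    rfl
  rw [h'] at h
  exact h

/-- Automorphisms of `(N, R)` restrict to automorphisms of the structure on `R`. -/
theorem StructureDefinable.exists_restrict (hR : StructureDefinable (withPred L) LR (predSet N))
    (σ : N ≃[withPred L] N) : ∃ ρ : predSet N ≃[LR] predSet N, ∀ x, (ρ x : N) = σ x := by
  let e : predSet N ≃ predSet N :=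
    σ.toEquiv.subtypeEquiv fun x => (mem_predSet_iff σ x).symm
  have he : ∀ x, (e x : N) = σ x := fun x => rfl
  refine ⟨⟨e, fun {n} f x => ?_, fun {n} r x => ?_⟩, he⟩
  · obtain ⟨y, hy1, hy2⟩ := (mem_iff_of_definable (hR.fun_definable n f) σ
      (Fin.snoc (α := fun _ => N) (fun i => (x i : N))
        (FirstOrder.Language.Structure.funMap f x : predSet N))).2
      ⟨x, by simp, by simp⟩
    have hy : y = e ∘ x := funext fun i => Subtype.ext (by simpa [he] using (hy1 i).symm)
    subst hy
    exact Subtype.ext ((he _).trans (by simpa using hy2))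
  · have key : ∀ z : Fin n → predSet N, (fun i => (z i : N)) ∈ {x : Fin n → N |
        ∃ y : Fin n → predSet N, (∀ i, x i = y i) ∧ FirstOrder.Language.Structure.RelMap r y} ↔
        FirstOrder.Language.Structure.RelMap r z := by
      intro z
      constructor
      · rintro ⟨y, h1, h2⟩
        rwa [show z = y from funext fun i => Subtype.ext (h1 i)]
      · exact fun h => ⟨z, fun _ => rfl, h⟩
    rw [← key x, ← mem_iff_of_definable (hR.rel_definable n r) σ]
    exact (key (e ∘ x)).symm

end Restriction

/-! ### Counting operations, and their invariance -/

section Operations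

variable {N : Type u}

theorem generated_eq_closure (F : Set (Op N)) (A : Set N) :
    generated F A = FirstOrder.Language.Substructure.closure (opLang F) A :=
  Set.ext fun _ => FirstOrder.Language.Substructure.mem_closure_iff_exists_term.symm

theorem mk_opLang_functions_le (F : Set (Op N)) : #(Σ n, (opLang F).Functions n) ≤ #F :=
  Cardinal.mk_le_of_injective
    (f := fun p : Σ n, (opLang F).Functions n => (⟨⟨p.1, p.2.1⟩, p.2.2⟩ : F)) (by
      rintro ⟨n, f, hf⟩ ⟨m, g, hg⟩ h
      simp only [Subtype.mk.injEq, Sigma.mk.injEq] at h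
      obtain ⟨rfl, h⟩ := h
      obtain rfl := eq_of_heq h
      rfl)

theorem mk_generated_le (F : Set (Op N)) (A : Set N) : #(generated F A) ≤ max ℵ₀ (#A + #F) := by
  have h := FirstOrder.Language.Substructure.lift_card_closure_le (L := opLang F) (s := A)
  simp only [Cardinal.lift_id] at h
  rw [generated_eq_closure]
  exact h.trans (max_le_max le_rfl (add_le_add le_rfl (mk_opLang_functions_le F)))

theorem realize_map_equiv {L : FirstOrder.Language.{u, u}} [L.Structure N] {F : Set (Op N)}
    (hF : ∀ f ∈ F, OpInvariant L f) (σ : N ≃[L] N) {α : Type*} (t : (opLang F).Term α)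
    (x : α → N) : σ (t.realize x) = t.realize (fun i => σ (x i)) := by
  induction t with
  | var i => rfl
  | func f ts ih =>
    have h := hF _ f.2 σ (fun i => (ts i).realize x)
    simp only [ih] at h
    exact h

theorem mk_sigma_formula_le (L : FirstOrder.Language.{u, u}) (g : ℕ → ℕ) :
    #(Σ n, L.Formula (Fin (g n))) ≤ max ℵ₀ L.card := by
  have h1 : ∀ n, #(L.Formula (Fin (g n))) ≤ max ℵ₀ L.card := fun n => by
    refine (Cardinal.mk_le_of_injective (f := fun φ : L.Formula (Fin (g n)) =>
      (⟨0, φ⟩ : Σ m, L.BoundedFormula (Fin (g n)) m)) (fun φ ψ h => by simpa using h)).trans ?_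
    refine FirstOrder.Language.BoundedFormula.card_le.trans (max_le (le_max_left _ _) ?_)
    refine (Cardinal.add_le_max _ _).trans (max_le (max_le ?_ ?_) (le_max_left _ _))
    · exact (Cardinal.lift_lt_aleph0.2 (Cardinal.lt_aleph0_of_finite _)).le.trans (le_max_left _ _)
    · simp
  rw [Cardinal.mk_sigma]
  refine (Cardinal.sum_le_sum _ _ h1).trans ?_
  rw [Cardinal.sum_const]
  simp only [Cardinal.mk_nat, Cardinal.lift_aleph0, Cardinal.lift_uzero]
  exact (Cardinal.mul_le_max _ _).trans (by simp)

/-- Choosing a formula that defines the graph is injective, and there are at most `max ℵ₀ L.card`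
formulas. -/
theorem mk_ops_le {L : FirstOrder.Language.{u, u}} [L.Structure N] {F : Set (Op N)}
    (hF : ∀ f ∈ F, OpDefinable L f) : #F ≤ max ℵ₀ L.card := by
  choose φ hφ using fun f : F => Set.empty_definable_iff.1 (hF f f.2)
  refine le_trans (Cardinal.mk_le_of_injective
    (f := fun f => (⟨f.1.1, φ f⟩ : Σ n, L.Formula (Fin (n + 1)))) ?_)
    (mk_sigma_formula_le L fun n => n + 1)
  rintro ⟨⟨n, f⟩, hf⟩ ⟨⟨m, g⟩, hg⟩ h
  simp only [Sigma.mk.injEq] at h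
  obtain ⟨rfl, h⟩ := h
  have h' := eq_of_heq h
  have hfg := hφ ⟨⟨n, f⟩, hf⟩
  rw [h', ← hφ ⟨⟨n, g⟩, hg⟩] at hfg
  have : f = g := by
    funext x
    have hx : (Fin.snoc x (f x) : Fin (n + 1) → N) ∈
        {x : Fin (n + 1) → N | x (Fin.last n) = f (fun i => x i.castSucc)} := by simp
    have hx' := hfg.subset hx
    simpa using hx'
  subst this
  rfl

/-- The language with one symbol for every interpretation of a symbol of `L` in `X`. -/
def interpLang (L : FirstOrder.Language.{u, u}) (X : Type u) [L.Structure X] :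
    FirstOrder.Language.{u, u} where
  Functions n := Set.range
    (FirstOrder.Language.Structure.funMap : L.Functions n → (Fin n → X) → X)
  Relations n := Set.range
    (FirstOrder.Language.Structure.RelMap : L.Relations n → (Fin n → X) → Prop)

instance (L : FirstOrder.Language.{u, u}) (X : Type u) [L.Structure X] :
    (interpLang L X).Structure X where
  funMap f x := f.1 x
  RelMap r x := r.1 x

/-- The symbols of `L` as symbols of `interpLang L X`. -/
def toInterpLang (L : FirstOrder.Language.{u, u}) (X : Type u) [L.Structure X] :
    L →ᴸ interpLang L X where
  onFunction _ f := ⟨_, f, rfl⟩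
  onRelation _ r := ⟨_, r, rfl⟩

instance (L : FirstOrder.Language.{u, u}) (X : Type u) [L.Structure X] :
    (toInterpLang L X).IsExpansionOn X where
  map_onFunction _ _ := rfl
  map_onRelation _ _ := rfl

/-- The language `LR` may have arbitrarily many symbols, but their interpretations are definable in
`N` and hence few. This is what bounds the number of operations in `FR`. -/
theorem StructureDefinable.card_interpLang_le {L LR : FirstOrder.Language.{u, u}} [L.Structure N]
    {R : Set N} [LR.Structure R] (hR : StructureDefinable L LR R) :
    (interpLang LR R).card ≤ max ℵ₀ L.card := by
  rw [FirstOrder.Language.card, FirstOrder.Language.Symbols, Cardinal.mk_sum]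
  simp only [Cardinal.lift_id]
  refine (Cardinal.add_le_max _ _).trans (max_le (max_le ?_ ?_) (le_max_left _ _))
  · choose φ hφ using fun p : Σ n, (interpLang LR R).Functions n =>
      Set.empty_definable_iff.1 (hR.fun_definable p.1 p.2.2.choose)
    refine le_trans (Cardinal.mk_le_of_injective
      (f := fun p => (⟨p.1, φ p⟩ : Σ n, L.Formula (Fin (n + 1)))) ?_)
      (mk_sigma_formula_le L fun n => n + 1)
    rintro ⟨n, f⟩ ⟨m, g⟩ h
    simp only [Sigma.mk.injEq] at h
    obtain ⟨rfl, h⟩ := h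
    have hfg := hφ ⟨n, f⟩
    rw [eq_of_heq h, ← hφ ⟨n, g⟩] at hfg
    have : f = g := Subtype.ext <| funext fun y => by
      obtain ⟨y', h1, h2⟩ := (Set.ext_iff.1 hfg (Fin.snoc (α := fun _ => N) (fun i => (y i : N)) (f.1 y : R))).1
        ⟨y, by simp, by simp only [Fin.snoc_last]; rw [f.2.choose_spec]⟩
      rw [g.2.choose_spec] at h2
      simp only [Fin.snoc_castSucc, Fin.snoc_last] at h1 h2
      rw [show y = y' from funext fun i => Subtype.ext (h1 i)] at h2 ⊢
      exact Subtype.ext h2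
    rw [this]
  · choose φ hφ using fun p : Σ n, (interpLang LR R).Relations n =>
      Set.empty_definable_iff.1 (hR.rel_definable p.1 p.2.2.choose)
    refine le_trans (Cardinal.mk_le_of_injective
      (f := fun p => (⟨p.1, φ p⟩ : Σ n, L.Formula (Fin n))) ?_)
      (mk_sigma_formula_le L fun n => n)
    have key : ∀ {n : ℕ} (f : (interpLang LR R).Relations n) (y : Fin n → R),
        (fun i => (y i : N)) ∈ {x : Fin n → N | ∃ y : Fin n → R, (∀ i, x i = y i) ∧
          FirstOrder.Language.Structure.RelMap f.2.choose y} ↔ f.1 y := by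
      intro n f y
      rw [f.2.choose_spec]
      constructor
      · rintro ⟨y', h1, h2⟩
        rwa [show y = y' from funext fun i => Subtype.ext (h1 i)]
      · exact fun h => ⟨y, fun _ => rfl, h⟩
    rintro ⟨n, f⟩ ⟨m, g⟩ h
    simp only [Sigma.mk.injEq] at h
    obtain ⟨rfl, h⟩ := h
    have hfg := hφ ⟨n, f⟩
    rw [eq_of_heq h, ← hφ ⟨n, g⟩] at hfg
    have : f = g := Subtype.ext <| funext fun y => propext <| by
      rw [← key f, ← key g]
      exact Set.ext_iff.1 hfg _
    rw [this]

theorem mk_allOps_le {L LR : FirstOrder.Language.{u, u}} [L.Structure N] {R : Set N}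
    [LR.Structure R] (hR : StructureDefinable L LR R) {FN : Set (Op N)}
    (hFN : ∀ f ∈ FN, OpDefinable L f) {FR : Set (Op R)} (hFR : ∀ f ∈ FR, OpDefinable LR f)
    (lam : N → R) : #(allOps FN FR lam) ≤ max ℵ₀ L.card := by
  have h1 := mk_ops_le hFN
  have h2 : #FR ≤ max ℵ₀ L.card :=
    (mk_ops_le fun f hf => (hFR f hf).map_expansion (toInterpLang LR R)).trans
      (max_le (le_max_left _ _) hR.card_interpLang_le)
  have h3 : ℵ₀ ≤ max ℵ₀ L.card := le_max_left _ _
  refine (Cardinal.mk_union_le _ _).trans (Cardinal.add_le_of_le h3 h1 ?_)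
  refine (Cardinal.mk_union_le _ _).trans (Cardinal.add_le_of_le h3
    (Cardinal.mk_image_le.trans h2) ?_)
  rw [Cardinal.mk_singleton]
  exact Cardinal.one_lt_aleph0.le.trans h3

end Operations

/-! ### Closure under the operations -/

section Generated

variable {N : Type u} {F : Set (Op N)}

theorem mem_generated_range {β : Type*} (f : β → N) {x : N} :
    x ∈ generated F (Set.range f) ↔ ∃ t : (opLang F).Term β, t.realize f = x := by
  constructor
  · rintro ⟨t, rfl⟩
    refine ⟨t.relabel fun y => y.2.choose, ?_⟩
    rw [FirstOrder.Language.Term.realize_relabel]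
    exact congrArg t.realize (funext fun y : Set.range f => y.2.choose_spec)
  · rintro ⟨t, rfl⟩
    refine ⟨t.relabel (Set.rangeFactorization f), ?_⟩
    rw [FirstOrder.Language.Term.realize_relabel]
    rfl

theorem generated_generated (A : Set N) : generated F (generated F A) = generated F A := by
  rw [generated_eq_closure F A, generated_eq_closure, FirstOrder.Language.Substructure.closure_eq]

theorem subset_generated (A : Set N) : A ⊆ generated F A := by
  rw [generated_eq_closure]
  exact FirstOrder.Language.Substructure.subset_closure

theorem generated_mono {A B : Set N} (h : A ⊆ B) : generated F A ⊆ generated F B := by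
  rw [generated_eq_closure, generated_eq_closure]
  exact FirstOrder.Language.Substructure.closure_mono h

theorem generated_subset {A B : Set N} (h : A ⊆ generated F B) : generated F A ⊆ generated F B :=
  (generated_mono h).trans (generated_generated B).subset

theorem op_mem_generated {A : Set N} {f : Op N} (hf : f ∈ F) {x : Fin f.1 → N}
    (hx : ∀ i, x i ∈ generated F A) : f.2 x ∈ generated F A := by
  rw [generated_eq_closure] at hx ⊢
  exact FirstOrder.Language.Substructure.fun_mem _
    (⟨f.2, hf⟩ : (opLang F).Functions f.1) x hx

theorem realize_mem_generated {G : Set (Op N)} (hG : G ⊆ F) {A : Set N} {α : Type*}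
    (t : (opLang G).Term α) {x : α → N} (hx : ∀ i, x i ∈ generated F A) :
    t.realize x ∈ generated F A := by
  induction t with
  | var i => exact hx i
  | func f ts ih => exact op_mem_generated (hG f.2) ih

theorem generated_subset_generated {G : Set (Op N)} (hG : G ⊆ F) {A B : Set N}
    (h : A ⊆ generated F B) : generated G A ⊆ generated F B := by
  rintro _ ⟨t, rfl⟩
  exact realize_mem_generated hG t fun i => h i.2

theorem mk_generated_lt {κ : Cardinal.{u}} (hκ : ℵ₀ < κ) (hF : #F < κ) {A : Set N} (hA : #A < κ) :
    #(generated F A) < κ :=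
  (mk_generated_le F A).trans_lt (max_lt hκ (Cardinal.add_lt_of_lt hκ.le hA hF))

end Generated

/-! ### The two cases in which a single member can be moved -/

section Single

theorem EqTp.of_params {L : FirstOrder.Language.{u, u}} {M : Type u} [L.Structure M] {α : Type*}
    {A : Set M} {x y : α → M}
    (h : ∀ (l : ℕ) (p : Fin l → M), (∀ i, p i ∈ A) → EqTp L (Sum.elim x p) (Sum.elim y p)) :
    EqTp L (Sum.elim (Subtype.val : A → M) x) (Sum.elim Subtype.val y) := by
  refine (EqTp.of_union (x := x) (y := y) (A := A) (B := ∅) fun l p hp => (h l p hp).of_comp ?_).of_comp ?_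
  · rintro (z | z)
    · exact z.2.elim
    · exact ⟨z, rfl, rfl⟩
  · rintro (z | z)
    · exact ⟨Sum.inl ⟨z, Or.inl z.2⟩, rfl, rfl⟩
    · exact ⟨Sum.inr z, rfl, rfl⟩

/-- In a distal structure, if an automorphism takes `d_c` to `d_{c'}`, then it does not change the
type over `d_{c'}` of an element `b` as in the definition of distality. -/
theorem IsDistal.eqTp_of_equiv {L : FirstOrder.Language.{u, u}} {N : Type u} [L.Structure N]
    (hN : IsDistal L N) {K : Type u} [LinearOrder K] {c : K} {l : ℕ} {d : K → Fin l → N} {b b' : N}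
    (hd : DistalityAssumptions L c d b) (c' : K)
    (hσ : EqTp L (Sum.elim (fun _ : Unit => b) (d c)) (Sum.elim (fun _ : Unit => b') (d c'))) :
    EqTp L (Sum.elim (fun _ : Unit => b) (d c')) (Sum.elim (fun _ : Unit => b') (d c')) := by
  refine EqTp.trans ?_ hσ
  refine ((indiscernibleOver_iff.1 (hN N K c l d b hd)).single (k := c') (k' := c)
    trivial trivial).of_comp ?_
  rintro (z | v)
  · exact ⟨Sum.inl ⟨b, rfl⟩, rfl, rfl⟩
  · exact ⟨Sum.inr v, rfl, rfl⟩

variable {L LR : FirstOrder.Language.{u, u}} {N : Type u} [L.Structure N] [unaryLang.Structure N]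
  [LR.Structure (predSet N)] {κ : Cardinal.{u}} {F : Set (Op N)}
  {K : Type u} [LinearOrder K] {c : K} {n : ℕ} {a : K → Fin n → N}

/-- The case of an element of `R`: distality of the structure on `R` compares `e` with its image
under an automorphism moving `a c` to `a c'`, and `h2` lifts the result to the expansion. -/
theorem exists_eqTp_of_mem_predSet (hR : StructureDefinable (withPred L) LR (predSet N))
    (hF : ∀ f ∈ F, OpInvariant (withPred L) f) (hκ : ℵ₀ < κ) (hFκ : #F < κ)
    (hhom : IsStronglyHomogeneous (withPred L) N κ) (hR_distal : IsDistal LR (predSet N))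
    (h2 : ∀ M : Set N, #M < κ → generated F M = M → ∀ b b' : predSet N,
        SameType LR {x : predSet N | (x : N) ∈ M} (fun _ : Unit => b) (fun _ => b') →
        SameType (withPred L) M (fun _ : Unit => (b : N)) (fun _ => (b' : N)))
    {e : predSet N} (hab : DistalityAssumptions (withPred L) c a (e : N)) :
    ∃ c' ≠ c, EqTp (withPred L) (Sum.elim (a c) (fun _ : Unit => (e : N)))
      (Sum.elim (a c') (fun _ : Unit => (e : N))) := by
  obtain ⟨hc, h0, hb⟩ := distalityAssumptions_iff.1 hab
  have hfin : ∀ x : N, #({x} : Set N) < κ := fun x => by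
    simpa using Cardinal.one_lt_aleph0.trans hκ
  have h0κ : #(∅ : Set N) < κ := by simpa using Cardinal.aleph0_pos.trans hκ
  obtain ⟨c', hc'⟩ := hc.nonempty_left
  obtain ⟨σ, -, hσ⟩ := h0.exists_equiv_single hκ.le hhom h0κ
    (k := c) (k' := c') trivial trivial
  obtain ⟨ρ, hρ⟩ := hR.exists_restrict σ
  set M := generated F (Set.range (a c')) with hM
  have hMκ : #M < κ := mk_generated_lt hκ hFκ
    ((Cardinal.lt_aleph0_of_finite _).trans hκ)
  have key : SameType LR {x : predSet N | (x : N) ∈ M} (fun _ : Unit => e) (fun _ => ρ e) := by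
    rw [sameType_iff]
    refine EqTp.of_params fun l p hp => ?_
    choose t ht using fun v => (mem_generated_range (a c')).1 (hp v)
    -- The terms have values in `R` at `a c'`, hence at every `a k`, because all members of the
    -- sequence are conjugate. So `d` is a sequence in `R`.
    have hmem : ∀ k v, (t v).realize (a k) ∈ predSet N := fun k v => by
      obtain ⟨τ, -, hτ⟩ := h0.exists_equiv_single hκ.le hhom h0κ
        (k := c') (k' := k) trivial trivial
      have := realize_map_equiv hF τ (t v) (a c')
      simp only [hτ] at this
      rw [← this, mem_predSet_iff, ht]
      exact (p v).2
    let d : K → Fin l → predSet N := fun k v => ⟨(t v).realize (a k), hmem k v⟩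
    have hd : p = d c' := funext fun v => Subtype.ext (ht v).symm
    have hρd : ∀ (τ : N ≃[withPred L] N) (ρ : predSet N ≃[LR] predSet N), (∀ x, (ρ x : N) = τ x) →
        ∀ k k', (∀ v, τ (a k v) = a k' v) → ∀ v, ρ (d k v) = d k' v := by
      intro τ ρ hρ k k' hk v
      refine Subtype.ext ?_
      rw [hρ, realize_map_equiv hF τ (t v) (a k)]
      simp only [hk]
      rfl
    have hDA : DistalityAssumptions LR c d e := by
      refine distalityAssumptions_iff.2 ⟨hc, Ind.of_equiv ?_, Ind.of_equiv ?_⟩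
      · intro m s s' hs hs' _ _
        obtain ⟨τ, -, hτ⟩ := h0.exists_equiv hκ.le hhom h0κ hs hs'
          (fun _ => trivial) (fun _ => trivial)
        obtain ⟨ρ, hρ⟩ := hR.exists_restrict τ
        exact ⟨ρ, fun x hx => hx.elim, fun i v => hρd τ ρ hρ _ _ (hτ i) v⟩
      · intro m s s' hs hs' hsc hsc'
        obtain ⟨τ, hτe, hτ⟩ := hb.exists_equiv hκ.le hhom (hfin _) hs hs' hsc hsc'
        obtain ⟨ρ, hρ⟩ := hR.exists_restrict τ
        refine ⟨ρ, ?_, fun i v => hρd τ ρ hρ _ _ (hτ i) v⟩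
        rintro x rfl
        exact Subtype.ext ((hρ x).trans (hτe x rfl))
    rw [hd]
    refine hR_distal.eqTp_of_equiv hDA c' (EqTp.of_equiv ρ ?_)
    rintro (z | v)
    · rfl
    · exact hρd σ ρ hρ c c' hσ v
  refine ⟨c', hc'.ne, ?_⟩
  have h := sameType_iff.1 (h2 M hMκ (generated_generated _) e (ρ e) key)
  refine EqTp.trans (y := Sum.elim (a c') (fun _ => (ρ e : N))) (EqTp.of_equiv σ ?_)
    (h.symm.of_comp ?_)
  · rintro (v | z)
    · exact hσ v
    · exact (hρ e).symm
  · rintro (v | z)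
    · exact ⟨Sum.inl ⟨a c' v, subset_generated _ ⟨v, rfl⟩⟩, rfl, rfl⟩
    · exact ⟨Sum.inr (), rfl, rfl⟩

/-- The case of a general `b`, given a set `Q` of parameters for which `hclosed` provides the
closure condition in `h3`. Indiscernibility over `Q` at all of `(i, j)`, including `c`, yields the
automorphism `σ` over `Q` with `a c ↦ a c'`. -/
theorem eqTp_of_lam_mem (hF : ∀ f ∈ F, OpInvariant (withPred L) f) (hκ : ℵ₀ < κ) (hFκ : #F < κ)
    (hhom : IsStronglyHomogeneous (withPred L) N κ) (hN_distal : IsDistal L N)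
    {FN : Set (Op N)} (hFN : FN ⊆ F) (lam : N → predSet N)
    (h3 : ∀ M : Set N, #M < κ → generated F M = M → ∀ b b' : N,
        SameType L M (fun _ : Unit => b) (fun _ => b') →
        (∀ x ∈ generated FN (insert b M), (lam x : N) ∈ M) →
        SameType (withPred L) M (fun _ : Unit => b) (fun _ => b'))
    (hc : IsDedekindAt c) {i j : K} (hij : c ∈ Set.Ioo i j) {b : N} {Q : Set N} (hQ : #Q < κ)
    (hQa : Ind (withPred L) Q a (Set.Ioo i j))
    (hQb : Ind (withPred L) (Q ∪ {b}) a (Set.Ioo i j \ {c}))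
    {c' : K} (hc' : c' ∈ Set.Ioo i j)
    (hclosed : ∀ x ∈ generated F (insert b (Set.range (a c') ∪ Q)),
      (lam x : N) ∈ generated F (Set.range (a c') ∪ Q)) :
    EqTp (withPred L) (Sum.elim (a c) (fun _ : Unit => b))
      (Sum.elim (a c') (fun _ : Unit => b)) := by
  obtain ⟨σ, hσQ, hσ⟩ := hQa.exists_equiv_single hκ.le hhom hQ hij hc'
  have hQbκ : #(Q ∪ {b} : Set N) < κ := (Cardinal.mk_union_le _ _).trans_lt
    (Cardinal.add_lt_of_lt hκ.le hQ (by simpa using Cardinal.one_lt_aleph0.trans hκ))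
  set M := generated F (Set.range (a c') ∪ Q) with hM
  have hMκ : #M < κ := mk_generated_lt hκ hFκ ((Cardinal.mk_union_le _ _).trans_lt
    (Cardinal.add_lt_of_lt hκ.le ((Cardinal.lt_aleph0_of_finite _).trans hκ) hQ))
  have key : SameType L M (fun _ : Unit => b) (fun _ => σ b) := by
    rw [sameType_iff]
    refine EqTp.of_params fun l p hp => ?_
    have hM' : M = generated F (Set.range (Sum.elim (a c') (Subtype.val : Q → N))) := by
      rw [Set.Sum.elim_range, Subtype.range_coe]
    rw [hM'] at hp
    choose t ht using fun v => (mem_generated_range _).1 (hp v)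
    let d : K → Fin l → N := fun k v => (t v).realize (Sum.elim (a k) (Subtype.val : Q → N))
    have hd : p = d c' := funext fun v => (ht v).symm
    have hτd : ∀ τ : N ≃[withPred L] N, (∀ x ∈ Q, τ x = x) → ∀ k k', (∀ v, τ (a k v) = a k' v) →
        ∀ v, τ (d k v) = d k' v := by
      intro τ hτQ k k' hk v
      rw [realize_map_equiv hF τ (t v)]
      refine congrArg (t v).realize (funext ?_)
      rintro (z | z)
      · exact hk z
      · exact hτQ z z.2
    -- Terms in `a k` with parameters from `Q` inherit both kinds of indiscernibility, because
    -- automorphisms over `Q` commute with them; passing to the reduct gives the assumptions in `N`.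
    have hDA : DistalityAssumptions L (⟨c, hij⟩ : Set.Ioo i j) (fun k => d k) b := by
      have hreduct : ∀ {A : Set N} {S : Set K}, Ind (withPred L) A d S → Ind L A d S :=
        fun h m s t hs ht hsS htS =>
          (h m s t hs ht hsS htS).reduct FirstOrder.Language.LHom.sumInl
      refine distalityAssumptions_iff.2 ⟨hc.Ioo hij, ?_, ?_⟩
      · refine (hreduct (S := Set.Ioo i j) (Ind.of_equiv ?_)).comp
          (f := fun k : Set.Ioo i j => (k : K)) (fun _ _ h => h) (fun k _ => k.2)
        intro m s s' hs hs' hsc hsc'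
        obtain ⟨τ, hτQ, hτ⟩ := hQa.exists_equiv hκ.le hhom hQ hs hs' hsc hsc'
        exact ⟨τ, fun x hx => hx.elim, fun i v => hτd τ hτQ _ _ (hτ i) v⟩
      · refine (hreduct (S := Set.Ioo i j \ {c}) (Ind.of_equiv ?_)).comp
          (f := fun k : Set.Ioo i j => (k : K)) (fun _ _ h => h)
          (fun k hk => ⟨k.2, fun h => hk (Subtype.ext h)⟩)
        intro m s s' hs hs' hsc hsc'
        obtain ⟨τ, hτQ, hτ⟩ := hQb.exists_equiv hκ.le hhom hQbκ hs hs' hsc hsc'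
        exact ⟨τ, fun x hx => hτQ x (Or.inr hx),
          fun i v => hτd τ (fun x hx => hτQ x (Or.inl hx)) _ _ (hτ i) v⟩
    rw [hd]
    refine hN_distal.eqTp_of_equiv hDA ⟨c', hc'⟩
      ((EqTp.of_equiv σ ?_).reduct FirstOrder.Language.LHom.sumInl)
    rintro (z | v)
    · rfl
    · exact hτd σ hσQ c c' hσ v
  have h := sameType_iff.1 (h3 M hMκ (generated_generated _) b (σ b) key fun x hx => by
    refine hclosed x (generated_subset_generated hFN ?_ hx)
    exact Set.insert_subset (subset_generated _ (Set.mem_insert _ _))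
      (generated_mono (Set.subset_insert _ _)))
  refine EqTp.trans (y := Sum.elim (a c') (fun _ => σ b)) (EqTp.of_equiv σ ?_)
    (h.symm.of_comp ?_)
  · rintro (v | z)
    · exact hσ v
    · rfl
  · rintro (v | z)
    · exact ⟨Sum.inl ⟨a c' v, subset_generated _ (Or.inl ⟨v, rfl⟩)⟩, rfl, rfl⟩
    · exact ⟨Sum.inr (), rfl, rfl⟩

end Single

/-! ### Closing off with few elements, and finitely many parameters in a term -/

section Closure

/-- Sets closed under at most `ν` finitary operations with countable sets of values exist in
size `ν`. -/
theorem exists_closed_subset {D : Type u} {ν : Cardinal.{u}} (hν : ℵ₀ ≤ ν) {T : ℕ → Type u}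
    (hT : ∀ l, #(T l) ≤ ν) (E : ∀ l, T l → (Fin l → D) → ℕ → D) :
    ∃ Q : Set D, #Q ≤ ν ∧ ∀ l t q, (∀ v, q v ∈ Q) → ∀ m, E l t q m ∈ Q := by
  let G : FirstOrder.Language.{u, 0} := ⟨fun l => T l × ℕ, fun _ => Empty⟩
  let _ : G.Structure D := ⟨fun {l} f q => E l f.1 q f.2, fun r => r.elim⟩
  refine ⟨FirstOrder.Language.Substructure.closure G (∅ : Set D), ?_, fun l t q hq m =>
    FirstOrder.Language.Substructure.fun_mem (L := G) _ (n := l) (t, m) q hq⟩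
  have h := FirstOrder.Language.Substructure.lift_card_closure_le (L := G) (s := (∅ : Set D))
  simp only [Cardinal.lift_id] at h
  refine h.trans (max_le hν ?_)
  simp only [Cardinal.mk_eq_zero, zero_add]
  rw [Cardinal.mk_sigma]
  refine (Cardinal.sum_le_sum _ (fun _ => ν) fun l => ?_).trans ?_
  · simp only [G, Cardinal.mk_prod, Cardinal.mk_nat, Cardinal.lift_aleph0, Cardinal.lift_uzero]
    exact Cardinal.mul_le_of_le hν (hT l) hν
  · simpa using Cardinal.mul_le_of_le hν hν le_rfl

variable {N : Type u} {F : Set (Op N)}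

theorem exists_finite_params {α : Type*} {P : Set N} (t : (opLang F).Term (α ⊕ P)) :
    ∃ E ⊆ P, E.Finite ∧ ∀ x : α → N,
      t.realize (Sum.elim x Subtype.val) ∈ generated F (Set.range x ∪ E) := by
  induction t with
  | var z =>
    rcases z with v | z
    · exact ⟨∅, Set.empty_subset _, Set.finite_empty,
        fun x => subset_generated _ (Or.inl ⟨v, rfl⟩)⟩
    · exact ⟨{z.1}, Set.singleton_subset_iff.2 z.2, Set.finite_singleton _,
        fun x => subset_generated _ (Or.inr rfl)⟩
  | func f ts ih =>
    choose E hEP hE hx using ih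
    refine ⟨⋃ i, E i, Set.iUnion_subset hEP, Set.finite_iUnion hE, fun x => ?_⟩
    exact op_mem_generated f.2 fun i => generated_mono
      (Set.union_subset_union_right _ (Set.subset_iUnion E i)) (hx i x)

/-- Separating a term from its parameters leaves a parameter-free family of terms, whose size does
not depend on the parameter set. -/
theorem exists_relabel_fin {L : FirstOrder.Language} {α P : Type*} (t : L.Term (α ⊕ P)) :
    ∃ (l : ℕ) (t' : L.Term (α ⊕ Fin l)) (q : Fin l → P), t'.relabel (Sum.map id q) = t := by
  induction t with
  | var z =>
    rcases z with v | z
    · exact ⟨0, FirstOrder.Language.Term.var (Sum.inl v), Fin.elim0, rfl⟩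
    · exact ⟨1, FirstOrder.Language.Term.var (Sum.inr 0), fun _ => z, rfl⟩
  | func f ts ih =>
    choose l t' q ht using ih
    let e := Fintype.equivFin (Σ i, Fin (l i))
    refine ⟨_, FirstOrder.Language.Term.func f fun i =>
      (t' i).relabel (Sum.map id fun v => e ⟨i, v⟩), fun z => q (e.symm z).1 (e.symm z).2, ?_⟩
    refine congrArg (FirstOrder.Language.Term.func f) (funext fun i => ?_)
    rw [FirstOrder.Language.Term.relabel_relabel, Sum.map_comp_map]
    conv_rhs => rw [← ht i]
    refine congrArg (fun g => (t' i).relabel (Sum.map id g)) (funext fun v => ?_)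
    have h : ∀ z, e.symm (e z) = z := e.symm_apply_apply
    rw [Function.comp_apply, h]

end Closure

section Components

variable {N K : Type u} {n : ℕ} {a : K → Fin n → N}

theorem components_mono {S T : Set K} (h : S ⊆ T) : components a S ⊆ components a T := by
  rintro x ⟨k, hk, hx⟩
  exact ⟨k, h hk, hx⟩

theorem mk_components_lt {κ : Cardinal.{u}} (hκ : ℵ₀ < κ) (hK : #K < κ) (S : Set K) :
    #(components a S) < κ := by
  have h : components a S ⊆ Set.range fun p : K × Fin n => a p.1 p.2 := by
    rintro x ⟨k, -, v, rfl⟩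
    exact ⟨(k, v), rfl⟩
  refine ((Cardinal.mk_le_mk_of_subset h).trans Cardinal.mk_range_le).trans_lt ?_
  simp only [Cardinal.mk_prod, Cardinal.lift_uzero, Cardinal.mk_fin, Cardinal.lift_natCast]
  exact Cardinal.mul_lt_of_lt hκ.le hK ((Cardinal.natCast_lt_aleph0 (n := n)).trans hκ)

end Components

/-! ### Indiscernibility over derived elements of `R` -/

section Derived

variable (L : FirstOrder.Language.{u, u}) {N : Type u} [L.Structure N] [unaryLang.Structure N]
  {K : Type u} [LinearOrder K] {n : ℕ} (a : K → Fin n → N) (b : N)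

/-- The components of the `a_k` with `k` outside of `(i, j)`, together with the elements of `R`
which are fixed by all automorphisms that fix these components and `b`. -/
def derived (i j : K) : Set N :=
  components a (Set.Ioo i j)ᶜ ∪ {x | x ∈ predSet N ∧ ∀ σ : N ≃[withPred L] N, σ b = b →
    (∀ y ∈ components a (Set.Ioo i j)ᶜ, σ y = y) → σ x = x}

variable {L a b}

theorem derived_mono {i j i' j' : K} (hi : i ≤ i') (hj : j' ≤ j) :
    derived L a b i j ⊆ derived L a b i' j' := by
  have h : components a (Set.Ioo i j)ᶜ ⊆ components a (Set.Ioo i' j')ᶜ :=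
    components_mono (Set.compl_subset_compl.2 (Set.Ioo_subset_Ioo hi hj))
  rintro x (hx | ⟨hx, hσ⟩)
  · exact Or.inl (h hx)
  · exact Or.inr ⟨hx, fun σ hσb hσy => hσ σ hσb fun y hy => hσy y (h hy)⟩

theorem map_of_mem_derived {i j : K} {x : N} (hx : x ∈ derived L a b i j)
    (σ : N ≃[withPred L] N) (hσb : σ b = b)
    (hσ : ∀ y ∈ components a (Set.Ioo i j)ᶜ, σ y = y) : σ x = x := by
  rcases hx with hx | ⟨-, hx⟩
  · exact hσ x hx
  · exact hx σ hσb hσ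

variable {κ : Cardinal.{u}} {c : K}

/-- Off `c`, automorphisms over `b` and the outside components witness indiscernibility, and they
fix the derived elements by definition. -/
theorem DistalityAssumptions.ind_derived_union (hab : DistalityAssumptions (withPred L) c a b)
    (hκ : ℵ₀ < κ) (hK : #K < κ) (hhom : IsStronglyHomogeneous (withPred L) N κ) {i j : K}
    (hij : c ∈ Set.Ioo i j) :
    Ind (withPred L) (derived L a b i j ∪ {b}) a (Set.Ioo i j \ {c}) := by
  have hb := (distalityAssumptions_iff.1 hab).2.2.outside i j
  refine Ind.of_equiv fun m s t hs ht hsS htS => ?_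
  obtain ⟨σ, hσ, hst⟩ := hb.exists_equiv hκ.le hhom ((Cardinal.mk_union_le _ _).trans_lt
    (Cardinal.add_lt_of_lt hκ.le (by simpa using Cardinal.one_lt_aleph0.trans hκ)
      (mk_components_lt hκ hK _))) hs ht (fun v => ⟨(hsS v).2, (hsS v).1⟩)
      (fun v => ⟨(htS v).2, (htS v).1⟩)
  have hσb : σ b = b := hσ b (Or.inl rfl)
  refine ⟨σ, ?_, hst⟩
  rintro x (hx | rfl)
  · refine map_of_mem_derived hx σ hσb fun y hy => hσ y (Or.inr (components_mono ?_ hy))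
    exact fun k hk => ⟨fun hkc => hk (hkc ▸ hij), hk⟩
  · exact hσb

/-- This is where the case of elements of `R` pays off: derived elements depend on `b`, yet
adjoining them keeps the sequence indiscernible at `c` as well. They are adjoined one at a time,
those already present being treated as part of the members of the sequence. -/
theorem DistalityAssumptions.ind_derived {LR : FirstOrder.Language.{u, u}}
    [LR.Structure (predSet N)] {F : Set (Op N)}
    (hR : StructureDefinable (withPred L) LR (predSet N))
    (hF : ∀ f ∈ F, OpInvariant (withPred L) f) (hκ : ℵ₀ < κ) (hFκ : #F < κ)
    (hhom : IsStronglyHomogeneous (withPred L) N κ) (hR_distal : IsDistal LR (predSet N))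
    (h2 : ∀ M : Set N, #M < κ → generated F M = M → ∀ b b' : predSet N,
        SameType LR {x : predSet N | (x : N) ∈ M} (fun _ : Unit => b) (fun _ => b') →
        SameType (withPred L) M (fun _ : Unit => (b : N)) (fun _ => (b' : N)))
    (hab : DistalityAssumptions (withPred L) c a b) (hK : #K < κ) {i j : K}
    (hij : c ∈ Set.Ioo i j) : Ind (withPred L) (derived L a b i j) a (Set.Ioo i j) := by
  classical
  have hb := hab.ind_derived_union hκ hK hhom hij
  have hfin : ∀ E : Finset N, (E : Set N) ⊆ derived L a b i j →
      Ind (withPred L) (components a (Set.Ioo i j)ᶜ ∪ E) a (Set.Ioo i j) := by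
    intro E
    induction E using Finset.induction_on with
    | empty =>
      intro _
      refine ((distalityAssumptions_iff.1 hab).2.1.outside i j).mono ?_ (by simp)
      rw [Set.compl_eq_univ_sdiff]
      simp
    | insert e E _ ih =>
      intro hE
      rw [Finset.coe_insert, Set.insert_subset_iff] at hE
      have hE' := ih hE.2
      rcases hE.1 with he | he
      · refine hE'.mono ?_ subset_rfl
        rw [Finset.coe_insert]
        exact Set.union_subset Set.subset_union_left
          (Set.insert_subset (Or.inl he) Set.subset_union_right)
      · have hsub : components a (Set.Ioo i j)ᶜ ∪ (E : Set N) ⊆ derived L a b i j :=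
          Set.union_subset Set.subset_union_left hE.2
        have key : Ind (withPred L) ((components a (Set.Ioo i j)ᶜ ∪ E) ∪ {e}) a (Set.Ioo i j) := by
          refine Ind.of_append fun l p hp => indiscernibleOver_subtype_iff.1 ?_
          refine indiscernibleOver_of_single (fun K _ c n a hae => ?_)
            (hE'.distalityAssumptions_append hab.dedekind hij (hb.mono ?_ subset_rfl) hp)
          · exact exists_eqTp_of_mem_predSet hR hF hκ hFκ hhom hR_distal h2 (e := ⟨e, he.1⟩) hae
          · exact Set.union_subset (hsub.trans Set.subset_union_left)
              (Set.singleton_subset_iff.2 (Or.inl hE.1))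
        refine key.mono ?_ subset_rfl
        rw [Finset.coe_insert, Set.insert_eq, Set.union_assoc, Set.union_comm {e}]
  refine (Ind.of_append (A := derived L a b i j) (B := ∅) fun l p hp => ?_).mono
    Set.subset_union_left subset_rfl
  let E : Finset N := Finset.univ.image p
  have hE : (E : Set N) = Set.range p := by simp [E]
  refine Ind.append (A := components a (Set.Ioo i j)ᶜ ∪ E)
    ((hfin E ?_).mono (by simp) subset_rfl) fun v => Or.inr (hE.symm.subset ⟨v, rfl⟩)
  rw [hE]
  rintro _ ⟨v, rfl⟩
  exact hp v

end Derived

/-! ### Variable separation over derived elements -/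

section Separation

variable {L : FirstOrder.Language.{u, u}} {N : Type u} [L.Structure N] [unaryLang.Structure N]
  {K : Type u} [LinearOrder K] {n : ℕ} {a : K → Fin n → N} {b : N} {κ μ : Cardinal.{u}} {c : K}
  {FN : Set (Op N)} {FR : Set (Op (predSet N))} {lam : N → predSet N}

/-- One step of the closing-off. Separation puts `lam t` into the closure of `a k` and finitely many
elements; those that come from `b` are derived for the smaller interval. -/
theorem AdmitsVariableSeparation.exists_truncation
    (h4 : AdmitsVariableSeparation L FN FR lam κ μ)
    (hF : ∀ f ∈ allOps FN FR lam, OpInvariant (withPred L) f) (hμ : ℵ₀ ≤ μ) (hK : #K < κ)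
    (hI : IsSaturatedDLO μ (Set.Iio c)) (hJ : IsSaturatedDLO μ (Set.Ioi c))
    (hc : IsDedekindAt c) {i j : K} (hij : c ∈ Set.Ioo i j)
    (hD : Ind (withPred L) (derived L a b i j) a (Set.Ioo i j))
    (hDb : Ind (withPred L) (derived L a b i j ∪ {b}) a (Set.Ioo i j \ {c}))
    {l : ℕ} (t : (opLang (allOps FN FR lam)).Term ((Fin n ⊕ Unit) ⊕ Fin l)) {q : Fin l → N}
    (hq : ∀ v, q v ∈ derived L a b i j) :
    ∃ i' j', c ∈ Set.Ioo i' j' ∧ ∃ E ⊆ derived L a b i' j', E.Finite ∧ ∀ k ∈ Set.Ioo i' j',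
      (lam (t.realize (Sum.elim (Sum.elim (a k) (fun _ => b)) q)) : N) ∈
        generated (allOps FN FR lam) (Set.range (a k) ∪ E) := by
  let F := allOps FN FR lam
  have hlamF : lamOp lam ∈ F := Or.inr (Or.inr rfl)
  let lamSym : (opLang F).Functions 1 := ⟨(lamOp lam).2, hlamF⟩
  -- The parameters `q` are moved into the members of the sequence, since separation only allows
  -- terms in `a k` and `b`.
  let g : (Fin n ⊕ Unit) ⊕ Fin l → Fin (n + l) ⊕ Unit :=
    Sum.elim (Sum.map (Fin.castAdd l) id) (fun v => Sum.inl (Fin.natAdd n v))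
  have hg : ∀ k, Sum.elim (Fin.append (a k) q) (fun _ : Unit => b) ∘ g =
      Sum.elim (Sum.elim (a k) (fun _ => b)) q := fun k => by
    funext z
    rcases z with (v | v) | v <;> simp [g]
  obtain ⟨I', J', htr, p, d, v, r, s, heq, hs⟩ := h4 (Set.Ioo i j) ⟨c, hij⟩
    ((Cardinal.mk_subtype_le _).trans_lt hK) (isSaturatedDLO_Iio_Ioo hμ hI hij)
    (isSaturatedDLO_Ioi_Ioo hμ hJ hij) (n + l) (fun k => Fin.append (a k) q) b
    (hD.distalityAssumptions_append hc hij hDb hq)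
    (FirstOrder.Language.Term.func lamSym fun _ => t.relabel g)
  have hs' := hs ⟨1, lamSym, _, rfl, Or.inr rfl⟩
  obtain ⟨⟨i', hi'⟩, hi'I⟩ := htr.left_nonempty
  obtain ⟨⟨j', hj'⟩, hj'J⟩ := htr.right_nonempty
  have hi'c : i' < c := htr.left_subset _ hi'I
  have hcj' : c < j' := htr.right_subset _ hj'J
  have hout : outsideParams (⟨c, hij⟩ : Set.Ioo i j) (fun k => Fin.append (a k) q) I' J' ⊆
      derived L a b i' j' := by
    rintro x ⟨k, hk, w, rfl⟩
    induction w using Fin.addCases with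
    | left w =>
      simp only [Fin.append_left]
      refine Or.inl ⟨k, fun hkI => ?_, w, rfl⟩
      rcases hk with ⟨h1, h2⟩ | ⟨h1, h2⟩
      · exact h2 (htr.left_final _ hi'I k hkI.1 h1)
      · exact h2 (htr.right_initial _ hj'J k h1 hkI.2)
    | right w =>
      simp only [Fin.append_right]
      exact derived_mono hi'.1.le hj'.2.le (hq w)
  -- The term has head `lam`, so the values `s(b)` lie in `R`. They are fixed by every automorphism
  -- fixing `b` and the outside components, since such an automorphism fixes all parameters of `s`.
  have hsD : ∀ w, (s w).realize (Sum.elim (fun _ => b) Subtype.val) ∈ derived L a b i' j' := by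
    refine fun w => Or.inr ⟨hs' w, fun σ hσb hσ => ?_⟩
    rw [realize_map_equiv hF σ]
    refine congrArg (s w).realize (funext ?_)
    rintro (z | z)
    · exact hσb
    · exact map_of_mem_derived (hout z.2) σ hσb hσ
  choose E hEP hE hEr using fun w => exists_finite_params (r w)
  refine ⟨i', j', ⟨hi'c, hcj'⟩, Set.range q ∪ ((⋃ w, E w) ∪
    Set.range fun w => (s w).realize (Sum.elim (fun _ => b) Subtype.val)), ?_, ?_, ?_⟩
  · refine Set.union_subset ?_ (Set.union_subset
      (Set.iUnion_subset fun w => (hEP w).trans hout) ?_)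
    · rintro _ ⟨w, rfl⟩
      exact derived_mono hi'.1.le hj'.2.le (hq w)
    · rintro _ ⟨w, rfl⟩
      exact hsD w
  · exact (Set.finite_range _).union ((Set.finite_iUnion hE).union (Set.finite_range _))
  · intro k hk
    have hkI : k ∈ Set.Ioo i j := ⟨hi'.1.trans hk.1, hk.2.trans hj'.2⟩
    have hk' : (⟨k, hkI⟩ : Set.Ioo i j) ∈ I' ∨ (⟨k, hkI⟩ : Set.Ioo i j) = ⟨c, hij⟩ ∨
        (⟨k, hkI⟩ : Set.Ioo i j) ∈ J' := by
      rcases lt_trichotomy k c with h | rfl | h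
      · exact Or.inl (htr.left_final _ hi'I ⟨k, hkI⟩ hk.1 h)
      · exact Or.inr (Or.inl rfl)
      · exact Or.inr (Or.inr (htr.right_initial _ hj'J ⟨k, hkI⟩ h hk.2))
    have h := heq ⟨k, hkI⟩ hk'
    have hl : (FirstOrder.Language.Term.func lamSym fun _ => t.relabel g).realize
        (Sum.elim (Fin.append (a k) q) (fun _ : Unit => b)) =
        (lam (t.realize (Sum.elim (Sum.elim (a k) (fun _ => b)) q)) : N) := by
      rw [← hg k, ← FirstOrder.Language.Term.realize_relabel]
      rfl
    rw [← hl, h]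
    refine realize_mem_generated Set.subset_union_left v ?_
    rintro (w | w)
    · refine generated_subset ?_ (hEr w (Fin.append (a k) q))
      rintro x (⟨z, rfl⟩ | hx)
      · induction z using Fin.addCases with
        | left z => exact subset_generated _ (Or.inl ⟨z, by simp⟩)
        | right z => exact subset_generated _ (Or.inr (Or.inl ⟨z, by simp⟩))
      · exact subset_generated _ (Or.inr (Or.inr (Or.inl (Set.mem_iUnion.2 ⟨w, hx⟩))))
    · exact subset_generated _ (Or.inr (Or.inr (Or.inr ⟨w, rfl⟩)))

theorem IsSaturatedDLO.exists_gt_of_Iio (hI : IsSaturatedDLO μ (Set.Iio c)) {ι : Type u}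
    (hι : #ι < μ) (f : ι → K) (hf : ∀ x, f x < c) : ∃ i < c, ∀ x, f x < i := by
  obtain ⟨i, hi, -⟩ := hI (Set.range fun x => (⟨f x, hf x⟩ : Set.Iio c)) ∅
    (Cardinal.mk_range_le.trans_lt hι)
    (by rw [Cardinal.mk_eq_zero]; exact pos_of_gt hι) (by simp)
  exact ⟨i, i.2, fun x => hi _ ⟨x, rfl⟩⟩

theorem IsSaturatedDLO.exists_lt_of_Ioi (hJ : IsSaturatedDLO μ (Set.Ioi c)) {ι : Type u}
    (hι : #ι < μ) (f : ι → K) (hf : ∀ x, c < f x) : ∃ j > c, ∀ x, j < f x := by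
  obtain ⟨i, -, hi⟩ := hJ ∅ (Set.range fun x => (⟨f x, hf x⟩ : Set.Ioi c))
    (by rw [Cardinal.mk_eq_zero]; exact pos_of_gt hι)
    (Cardinal.mk_range_le.trans_lt hι) (by simp)
  exact ⟨i, i.2, fun x => hi _ ⟨x, rfl⟩⟩

end Separation

/-! ### Closing off, and the conclusion -/

section Main

variable {L LR : FirstOrder.Language.{u, u}} {N : Type u} [L.Structure N] [unaryLang.Structure N]
  [LR.Structure (predSet N)] {FN : Set (Op N)} {FR : Set (Op (predSet N))} {lam : N → predSet N}

theorem map_lam (hlam : OpDefinable (withPred L) (lamOp lam)) (σ : N ≃[withPred L] N) (x : N) :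
    σ (lam x) = lam (σ x) :=
  hlam.opInvariant σ fun _ => x

theorem opInvariant_of_mem_allOps (hR : StructureDefinable (withPred L) LR (predSet N))
    (hFN : ∀ f ∈ FN, OpDefinable L f) (hFR : ∀ f ∈ FR, OpDefinable LR f)
    (hlam : OpDefinable (withPred L) (lamOp lam)) :
    ∀ f ∈ allOps FN FR lam, OpInvariant (withPred L) f := by
  rintro f (hf | ⟨h, hh, rfl⟩ | rfl)
  · exact ((hFN f hf).map_expansion FirstOrder.Language.LHom.sumInl).opInvariant
  · intro σ (x : Fin h.1 → N)
    obtain ⟨ρ, hρ⟩ := hR.exists_restrict σ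
    have h1 := congrArg Subtype.val ((hFR h hh).opInvariant ρ fun i => lam (x i))
    have h2 : ∀ i, ρ (lam (x i)) = lam (σ (x i)) := fun i =>
      Subtype.ext ((hρ _).trans (map_lam hlam σ (x i)))
    rw [hρ] at h1
    simp only [h2] at h1
    exact h1
  · exact hlam.opInvariant

theorem DistalityAssumptions.exists_eqTp
    {K : Type u} [LinearOrder K] {n : ℕ} {a : K → Fin n → N} {b : N} {c : K}
    (hR : StructureDefinable (withPred L) LR (predSet N))
    (hFN : ∀ f ∈ FN, OpDefinable L f) (hFR : ∀ f ∈ FR, OpDefinable LR f)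
    (hlam : OpDefinable (withPred L) (lamOp lam)) {κ μ : Cardinal.{u}}
    (hμ : max ℵ₀ (withPred L).card < μ) (hκ : μ < κ)
    (hhom : IsStronglyHomogeneous (withPred L) N κ)
    (hN_distal : IsDistal L N) (hR_distal : IsDistal LR (predSet N))
    (h2 : ∀ M : Set N, #M < κ → generated (allOps FN FR lam) M = M →
      ∀ b b' : predSet N,
        SameType LR {x : predSet N | (x : N) ∈ M} (fun _ : Unit => b) (fun _ => b') →
        SameType (withPred L) M (fun _ : Unit => (b : N)) (fun _ => (b' : N)))
    (h3 : ∀ M : Set N, #M < κ → generated (allOps FN FR lam) M = M →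
      ∀ b b' : N,
        SameType L M (fun _ : Unit => b) (fun _ => b') →
        (∀ x ∈ generated FN (insert b M), (lam x : N) ∈ M) →
        SameType (withPred L) M (fun _ : Unit => b) (fun _ => b'))
    (h4 : AdmitsVariableSeparation L FN FR lam κ μ) (hK : #K < κ)
    (hI : IsSaturatedDLO μ (Set.Iio c)) (hJ : IsSaturatedDLO μ (Set.Ioi c))
    (hab : DistalityAssumptions (withPred L) c a b) :
    ∃ c' ≠ c, EqTp (withPred L) (Sum.elim (a c) (fun _ : Unit => b))
      (Sum.elim (a c') (fun _ : Unit => b)) := by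
  set ν := max ℵ₀ (withPred L).card with hν_def
  have hν : ℵ₀ ≤ ν := le_max_left _ _
  have hc := hab.dedekind
  have hF := opInvariant_of_mem_allOps hR hFN hFR hlam
  have hFν : #(allOps FN FR lam) ≤ ν := mk_allOps_le (LR := LR) hR
    (fun f hf => (hFN f hf).map_expansion FirstOrder.Language.LHom.sumInl) hFR lam
  have hκ0 : ℵ₀ < κ := (hν.trans_lt hμ).trans hκ
  have hFκ := (hFν.trans_lt hμ).trans hκ
  have hD : ∀ {i j}, c ∈ Set.Ioo i j → Ind (withPred L) (derived L a b i j) a (Set.Ioo i j) :=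
    fun hij => hab.ind_derived hR hF hκ0 hFκ hhom hR_distal h2 hK hij
  have hDb : ∀ {i j}, c ∈ Set.Ioo i j →
      Ind (withPred L) (derived L a b i j ∪ {b}) a (Set.Ioo i j \ {c}) :=
    fun hij => hab.ind_derived_union hκ0 hK hhom hij
  let D : Type u := {x : N // ∃ i j, c ∈ Set.Ioo i j ∧ x ∈ derived L a b i j}
  choose i₁ j₁ hc₁ hD₁ using fun x : D => x.2
  let T : ℕ → Type u := fun l => (opLang (allOps FN FR lam)).Term ((Fin n ⊕ Unit) ⊕ Fin l)
  have hT : ∀ l, #(T l) ≤ ν := fun l => by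
    refine FirstOrder.Language.Term.card_le.trans (max_le hν ?_)
    rw [Cardinal.mk_sum]
    refine Cardinal.add_le_of_le hν ((Cardinal.lift_lt_aleph0.2
      (Cardinal.lt_aleph0_of_finite _)).le.trans hν) ?_
    rw [Cardinal.lift_uzero]
    exact (mk_opLang_functions_le _).trans hFν
  have step : ∀ (l : ℕ) (t : T l) (q : Fin l → D), ∃ i j, c ∈ Set.Ioo i j ∧ ∃ E : ℕ → D,
      ∀ k ∈ Set.Ioo i j, (lam (t.realize (Sum.elim (Sum.elim (a k) (fun _ => b))
        (fun v => (q v : N)))) : N) ∈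
          generated (allOps FN FR lam) (Set.range (a k) ∪ Set.range fun m => (E m : N)) := by
    intro l t q
    obtain ⟨i₀, hi₀, hi⟩ := hI.exists_gt_of_Iio (ι := ULift (Fin l))
      ((Cardinal.lt_aleph0_of_finite _).trans (hν.trans_lt hμ))
      (fun v => i₁ (q v.down)) (fun v => (hc₁ _).1)
    obtain ⟨j₀, hj₀, hj⟩ := hJ.exists_lt_of_Ioi (ι := ULift (Fin l))
      ((Cardinal.lt_aleph0_of_finite _).trans (hν.trans_lt hμ))
      (fun v => j₁ (q v.down)) (fun v => (hc₁ _).2)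
    obtain ⟨i, j, hij, E, hED, hE, hmem⟩ := h4.exists_truncation hF (hν.trans hμ.le) hK hI hJ hc
      (i := i₀) (j := j₀) ⟨hi₀, hj₀⟩ (hD ⟨hi₀, hj₀⟩) (hDb ⟨hi₀, hj₀⟩) t (q := fun v => (q v : N))
      (fun v => derived_mono (hi ⟨v⟩).le (hj ⟨v⟩).le (hD₁ (q v)))
    -- Adjoining `lam b` makes the finite set nonempty, so that it can be enumerated by `ℕ`.
    have hlamb : (lam b : N) ∈ derived L a b i j := Or.inr ⟨(lam b).2, fun σ hσ _ => by
      rw [map_lam hlam, hσ]⟩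
    obtain ⟨e, he⟩ := (hE.insert (lam b : N)).countable.exists_eq_range (Set.insert_nonempty _ _)
    refine ⟨i, j, hij, fun m => ⟨e m, i, j, hij, ?_⟩, fun k hk => ?_⟩
    · exact Set.insert_subset hlamb hED (he.symm.subset ⟨m, rfl⟩)
    · refine generated_mono (Set.union_subset_union_right _ ?_) (hmem k hk)
      show E ⊆ Set.range e
      rw [← he]
      exact Set.subset_insert _ _
  choose i₂ j₂ hc₂ E hE using step
  obtain ⟨Q, hQν, hQ⟩ := exists_closed_subset hν hT E
  -- One truncation for each term with parameters from `Q`, and one for each element of `Q`: fewer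
  -- than `μ` in all, so saturation on both sides of `c` yields a common interval `(i, j)`.
  let ι : Type u := (Σ l, T l × (Fin l → Q)) ⊕ Q
  have hι : #ι < μ := by
    refine lt_of_le_of_lt ?_ hμ
    rw [Cardinal.mk_sum]
    simp only [Cardinal.lift_id]
    refine Cardinal.add_le_of_le hν ?_ hQν
    rw [Cardinal.mk_sigma]
    refine (Cardinal.sum_le_sum _ (fun _ => ν) fun l => ?_).trans ?_
    · simp only [Cardinal.mk_prod, Cardinal.lift_id]
      refine Cardinal.mul_le_of_le hν (hT l) ?_
      rw [Cardinal.mk_arrow, Cardinal.lift_uzero, Cardinal.mk_fin, Cardinal.lift_natCast]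
      refine (Cardinal.power_le_power_right hQν).trans ?_
      exact_mod_cast Cardinal.power_nat_le hν
    · simpa using Cardinal.mul_le_of_le hν hν le_rfl
  obtain ⟨i, hic, hi⟩ := hI.exists_gt_of_Iio hι
    (Sum.elim (fun p => i₂ p.1 p.2.1 fun v => p.2.2 v) fun x => i₁ x) (by
      rintro (p | x)
      exacts [(hc₂ _ _ _).1, (hc₁ _).1])
  obtain ⟨j, hcj, hj⟩ := hJ.exists_lt_of_Ioi hι
    (Sum.elim (fun p => j₂ p.1 p.2.1 fun v => p.2.2 v) fun x => j₁ x) (by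
      rintro (p | x)
      exacts [(hc₂ _ _ _).2, (hc₁ _).2])
  have hij : c ∈ Set.Ioo i j := ⟨hic, hcj⟩
  have hQD : Subtype.val '' Q ⊆ derived L a b i j := by
    rintro _ ⟨x, hx, rfl⟩
    exact derived_mono (hi (Sum.inr ⟨x, hx⟩)).le (hj (Sum.inr ⟨x, hx⟩)).le (hD₁ x)
  obtain ⟨c', hic', hc'c⟩ := hc.no_max_left i hic
  have hc' : c' ∈ Set.Ioo i j := ⟨hic', hc'c.trans hcj⟩
  refine ⟨c', hc'c.ne, eqTp_of_lam_mem hF hκ0 hFκ hhom hN_distal Set.subset_union_left lam h3 hc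
    hij (Q := Subtype.val '' Q) ((Cardinal.mk_image_le.trans_lt (hQν.trans_lt hμ)).trans hκ)
    ((hD hij).mono hQD subset_rfl)
    ((hDb hij).mono (Set.union_subset_union_left _ hQD) subset_rfl) hc' fun x hx => ?_⟩
  have hrange : insert b (Set.range (a c') ∪ Subtype.val '' Q) =
      Set.range (Sum.elim (Sum.elim (a c') (fun _ : Unit => b)) (fun x : Q => (x.1 : N))) := by
    rw [Set.Sum.elim_range, Set.Sum.elim_range, Set.range_const, Set.union_singleton,
      Set.insert_union]
    congr 2
    exact Set.image_eq_range _ _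
  rw [hrange] at hx
  obtain ⟨t, rfl⟩ := (mem_generated_range _).1 hx
  obtain ⟨l, t, q, rfl⟩ := exists_relabel_fin t
  rw [FirstOrder.Language.Term.realize_relabel, Sum.elim_comp_map]
  refine generated_mono (Set.union_subset_union_right _ ?_) (hE l t (fun v => q v) c' ⟨?_, ?_⟩)
  · rintro _ ⟨m, rfl⟩
    exact ⟨_, hQ l t _ (fun v => (q v).2) m, rfl⟩
  · exact (hi (Sum.inl ⟨l, t, q⟩)).trans hic'
  · exact hc'c.trans (hcj.trans (hj (Sum.inl ⟨l, t, q⟩)))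

end Main

end DistalExpansion

theorem mainTheorem1
    (L LR : FirstOrder.Language.{u, u}) (N : Type u) [L.Structure N] [unaryLang.Structure N]
    [LR.Structure (predSet N)]
    (hR : StructureDefinable (withPred L) LR (predSet N))
    (FN : Set (Op N)) (hFN : ∀ f ∈ FN, OpDefinable L f)
    (FR : Set (Op (predSet N))) (hFR : ∀ f ∈ FR, OpDefinable LR f)
    (lam : N → predSet N) (hlam : OpDefinable (withPred L) (lamOp lam))
    -- the expansion is a monster model
    (κ μ : Cardinal.{u}) (hμ : ℵ₀ + (withPred L).card < μ) (hκ : 2 ^ μ < κ)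
    (hsat : IsSaturated (withPred L) N κ)
    (hhom : IsStronglyHomogeneous (withPred L) N κ)
    -- distality of the two given structures
    (hN_distal : IsDistal L N) (hR_distal : IsDistal LR (predSet N))
    -- types of elements of `R` in the expansion are determined by their types in `R`
    (h2 : ∀ M : Set N, #M < κ → generated (allOps FN FR lam) M = M →
      ∀ b b' : predSet N,
        SameType LR {x : predSet N | (x : N) ∈ M} (fun _ : Unit => b) (fun _ => b') →
        SameType (withPred L) M (fun _ : Unit => (b : N)) (fun _ => (b' : N)))
    -- types in the expansion are determined by types in `N` under the closure assumption
    (h3 : ∀ M : Set N, #M < κ → generated (allOps FN FR lam) M = M →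
      ∀ b b' : N,
        SameType L M (fun _ : Unit => b) (fun _ => b') →
        (∀ x ∈ generated FN (insert b M), (lam x : N) ∈ M) →
        SameType (withPred L) M (fun _ : Unit => b) (fun _ => b'))
    -- variable separation
    (h4 : AdmitsVariableSeparation L FN FR lam κ μ) :
    IsDistal (withPred L) N := by
  have hν : max ℵ₀ (withPred L).card < μ := (max_le le_self_add le_add_self).trans_lt hμ
  have hμ0 : ℵ₀ ≤ μ := (le_max_left _ _).trans hν.le
  obtain ⟨X, _, hX, hsatX⟩ := exists_isSaturatedDLO μ hμ0
  -- Any point serves as the cut, because both sides of a point in a `μ`-saturated dense order are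
  -- again `μ`-saturated.
  obtain ⟨c, -⟩ := hsatX ∅ ∅ (by simpa using Cardinal.aleph0_pos.trans_le hμ0)
    (by simpa using Cardinal.aleph0_pos.trans_le hμ0) (by simp)
  have hμκ : μ < κ := (Cardinal.cantor μ).trans hκ
  exact isDistal_of_isSaturated (hμ0.trans hμκ.le) hsat X (hX.trans_lt hκ)
    (hsatX.isDedekindAt hμ0 c) fun n a b hab =>
      hab.exists_eqTp hR hFN hFR hlam hν hμκ hhom hN_distal hR_distal h2 h3 h4 (hX.trans_lt hκ)
        (hsatX.Iio hμ0 c) (hsatX.Ioi hμ0 c)
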